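/- Let $k\ge 1$, $V=\{0,\dots,k\}$, let $R,T$ be unary and $S_1,\dots,S_k$ binary relation symbols, pairwise distinct, and let $h_{k,0}=\exists x\exists y\,(R(x)\wedge S_1(x,y))$, $h_{k,i}=\exists x\exists y\,(S_i(x,y)\wedge S_{i+1}(x,y))$ for $1\le i<k$, and $h_{k,k}=\exists x\exists y\,(S_k(x,y)\wedge T(y))$. For a Boolean function $\varphi:2^V\to\{0,1\}$ let $Q_\varphi$ be the Boolean query obtained from $\varphi$ by substituting $h_{k,i}$ for each variable $i\in V$. The $\mathcal H^+$-queries are the queries $Q_\varphi$ with $k\ge 1$ and $\varphi$ monotone (they are equivalent to unions of conjunctive queries). Call $\varphi$ degenerate if there is a variable in $V$ on which it does not depend. For monotone $\varphi$, let $C_0\wedge\dots\wedge C_n$ be its unique minimized CNF, each clause being identified with the set of its variables, let $L=\{\bigcup_{i\in s}C_i : s\subseteq\{0,\dots,n\}\}$ be ordered by reversed inclusion, with least element $\hat 0=\bigcup_i C_i$ and greatest element $\hat 1=\emptyset$, and let $\mu$ be the Möbius function of the poset $L$. By the dichotomy criterion of Dalvi and Suciu, the $\mathcal H^+$-query $Q_\varphi$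 is safe if and only if $\varphi$ is degenerate or $\mu(\hat 0,\hat 1)=0$. A deterministic decomposable circuit (d-D) is a Boolean circuit with $\wedge$-, $\vee$-, $\neg$- and variable gates in which any two distinct inputs of an $\wedge$-gate depend on disjoint sets of variables, and any two distinct inputs of an $\vee$-gate capture disjoint Boolean functions. The lineage of a Boolean query $Q$ over a database $D$ is the Boolean function on the facts of $D$ that maps each $D'\subseteq D$ to the truth value of $Q$ on $D'$. **Corollary.** For every safe $\mathcal H^+$-query $Q_\varphi$ there is an algorithm which, given any database $D$ over the relations $R,S_1,\dots,S_k,T$, computes in time polynomial in the size of $D$ (data complexity: $k$ and $\varphi$ are fixed) a d-D that represents the lineage of $Q_\varphi$ over $D$. -/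

import Mathlib

namespace HQuery

/-! ### Boolean functions on `V = {0, …, k}` -/

/-- A Boolean function on the variables `V = {0, …, k}`; a valuation is a subset of `V`.
It is monotone in the usual sense iff it is `Monotone` for `⊆` and `false ≤ true`. -/
abbrev BoolFun (k : ℕ) : Type := Finset (Fin (k + 1)) → Bool

/-- The valuation `ν` with the membership of `l` flipped. -/
def flip {k : ℕ} (ν : Finset (Fin (k + 1))) (l : Fin (k + 1)) : Finset (Fin (k + 1)) :=
  if l ∈ ν then ν.erase l else insert l ν

/-- `φ` depends on the variable `l`. -/
def DependsOn {k : ℕ} (φ : BoolFun k) (l : Fin (k + 1)) : Prop :=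
  ∃ ν, φ ν ≠ φ (flip ν l)

/-- `φ` is nondegenerate when it depends on all its variables, and degenerate otherwise. -/
def Nondegenerate {k : ℕ} (φ : BoolFun k) : Prop := ∀ l, DependsOn φ l

/-! ### The CNF lattice, its Möbius function and safety -/

/-- `F` is a minimized CNF of the monotone function `φ`: a set of clauses (a clause being the
set of its variables), none of which is a subset of another, whose conjunction is `φ`. -/
def IsMinCNF {k : ℕ} (F : Finset (Finset (Fin (k + 1)))) (φ : BoolFun k) : Prop :=
  (∀ ν, φ ν = true ↔ ∀ C ∈ F, (C ∩ ν).Nonempty) ∧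
    IsAntichain (· ⊆ ·) (F : Set (Finset (Fin (k + 1))))

/-- The CNF lattice: the unions of subsets of the set `F` of clauses, ordered by reversed
inclusion. -/
abbrev CNFLattice {k : ℕ} (F : Finset (Finset (Fin (k + 1)))) : Type :=
  {d : (Finset (Fin (k + 1)))ᵒᵈ // ∃ s ⊆ F, OrderDual.ofDual d = s.biUnion id}

noncomputable instance {k : ℕ} (F : Finset (Finset (Fin (k + 1)))) : Fintype (CNFLattice F) :=
  Fintype.ofFinite _

open Classical in
noncomputable instance {k : ℕ} (F : Finset (Finset (Fin (k + 1)))) :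
    LocallyFiniteOrder (CNFLattice F) :=
  Fintype.toLocallyFiniteOrder

/-- The least element of the CNF lattice: the union of all clauses. -/
def latBot {k : ℕ} (F : Finset (Finset (Fin (k + 1)))) : CNFLattice F :=
  ⟨OrderDual.toDual (F.biUnion id), F, Finset.Subset.refl F, rfl⟩

/-- The greatest element of the CNF lattice: the empty union. -/
def latTop {k : ℕ} (F : Finset (Finset (Fin (k + 1)))) : CNFLattice F :=
  ⟨OrderDual.toDual ∅, ∅, Finset.empty_subset F, rfl⟩

open Classical in
/-- The value of the Möbius function of the CNF lattice from the least to the greatest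
element. -/
noncomputable def cnfMoebius {k : ℕ} (F : Finset (Finset (Fin (k + 1)))) : ℤ :=
  IncidenceAlgebra.mu ℤ (latBot F) (latTop F)

/-- The Dalvi–Suciu criterion for the UCQ `Q_φ`, `φ` monotone, to be safe: either `φ` is
degenerate, or the Möbius function of the CNF lattice of `φ` vanishes between the least and the
greatest element. -/
def IsSafe {k : ℕ} (φ : BoolFun k) : Prop :=
  ¬ Nondegenerate φ ∨ ∃ F, IsMinCNF F φ ∧ cnfMoebius F = 0

/-! ### Databases and queries -/

/-- Constants of databases are bit strings. -/
abbrev Const : Type := List Bool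

/-- Facts over the unary relations `R`, `T` and the binary relations `S_1, …, S_k`;
`S j` stands for `S_{j+1}`. -/
inductive Fact (k : ℕ) : Type
  | R (a : Const) : Fact k
  | S (j : Fin k) (a b : Const) : Fact k
  | T (b : Const) : Fact k
  deriving DecidableEq

/-- A database is a finite set of facts. -/
abbrev Database (k : ℕ) : Type := Finset (Fact k)

/-- A Boolean query. -/
abbrev Query (k : ℕ) : Type := Database k → Prop

/-- The atoms `R(x), S_1(x,y), …, S_k(x,y), T(y)`, numbered from `0` to `k + 1`. -/
def atom (k : ℕ) (j : ℕ) (x y : Const) : Fact k :=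
  if j = 0 then .R x
  else if h : j - 1 < k then .S ⟨j - 1, h⟩ x y
  else .T y

/-- `h_{k,i}`, i.e. (for `k ≥ 1`) `∃ x y, R(x) ∧ S_1(x,y)` if `i = 0`,
`∃ x y, S_i(x,y) ∧ S_{i+1}(x,y)` if `1 ≤ i < k`, and `∃ x y, S_k(x,y) ∧ T(y)` if `i = k`. -/
def h (k : ℕ) (i : Fin (k + 1)) : Query k := fun D =>
  ∃ x y : Const, atom k i x y ∈ D ∧ atom k (i + 1) x y ∈ D

open Classical in
/-- The query `Q_φ`, obtained from `φ` by substituting `h_{k,i}` for each variable `i`. -/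
noncomputable def Qof {k : ℕ} (φ : BoolFun k) : Query k := fun D =>
  φ (Finset.univ.filter fun i => h k i D) = true

/-! ### Circuits and d-Ds -/

/-- Gates of a Boolean circuit over the variables `X`; the numbers refer to the input gates.
The `∧`-gate (`∨`-gate) without inputs is the constant true (false). -/
inductive Gate (X : Type) : Type
  | var (x : X) : Gate X
  | not (i : ℕ) : Gate X
  | and (is : List ℕ) : Gate X
  | or (is : List ℕ) : Gate X

/-- The numbers of the input gates of a gate. -/
def Gate.inputs {X : Type} : Gate X → List ℕ
  | .var _ => []
  | .not i => [i]
  | .and is => is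
  | .or is => is

/-- A circuit is the list of its gates, in reverse topological order: the head of the list is the
output gate, and the number of a gate is the number of gates that come after it in the list. -/
abbrev Circuit (X : Type) : Type := List (Gate X)

namespace Circuit

/-- The Boolean function captured by gate number `i`; a valuation is the set `ν` of the variables
that are true. (A number that belongs to no gate gets the value false; this never matters for
well-formed circuits.) -/
def value {X : Type} (ν : Set X) : Circuit X → ℕ → Prop
  | [], _ => False
  | g :: c, n =>
    if n = c.length then
      match g with
      | .var x => x ∈ ν
      | .not i => ¬ value ν c i
      | .and is => ∀ i ∈ is, value ν c i
      | .or is => ∃ i ∈ is, value ν c i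
    else value ν c n

/-- The Boolean function captured by the circuit, i.e. by its output gate. -/
def output {X : Type} (ν : Set X) (c : Circuit X) : Prop := c.value ν (c.length - 1)

/-- The set of the variables from which there is a directed path to gate number `i`. -/
def vars {X : Type} : Circuit X → ℕ → Set X
  | [], _ => ∅
  | g :: c, n =>
    if n = c.length then
      match g with
      | .var x => {x}
      | .not i => vars c i
      | .and is => ⋃ i ∈ is, vars c i
      | .or is => ⋃ i ∈ is, vars c i
    else vars c n

/-- There is an output gate, all wires go to earlier gates, and the variables are in `V`. -/
def WellFormed {X : Type} (V : Set X) (c : Circuit X) : Prop :=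
  c ≠ [] ∧ (∀ g rest, (g :: rest) <:+ c → ∀ i ∈ g.inputs, i < rest.length) ∧
    ∀ x, Gate.var x ∈ c → x ∈ V

/-- Any two inputs of an `∧`-gate depend on disjoint sets of variables. -/
def Decomposable {X : Type} (c : Circuit X) : Prop :=
  ∀ is rest, (Gate.and is :: rest) <:+ c →
    is.Pairwise fun i j => Disjoint (vars rest i) (vars rest j)

/-- Any two inputs of an `∨`-gate capture disjoint Boolean functions. -/
def Deterministic {X : Type} (c : Circuit X) : Prop :=
  ∀ is rest, (Gate.or is :: rest) <:+ c →
    is.Pairwise fun i j => ∀ ν : Set X, ¬ (value ν rest i ∧ value ν rest j)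

/-- `c` is a deterministic decomposable circuit (d-D) on the variables `V`. -/
def IsDD {X : Type} (V : Set X) (c : Circuit X) : Prop :=
  c.WellFormed V ∧ c.Decomposable ∧ c.Deterministic

end Circuit

/-- The circuit `c` represents the lineage of `Q` over `D`, which is the Boolean function on the
facts of `D` that maps each `D' ⊆ D` to the truth value of `Q` on `D'`. -/
def RepresentsLineage {k : ℕ} (Q : Query k) (D : Database k) (c : Circuit (Fact k)) : Prop :=
  ∀ D' : Database k, D' ⊆ D → (c.output (D' : Set (Fact k)) ↔ Q D')

/-! ### The machine model: Jones's WHILE language over binary trees, with running times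

Programs have finitely many registers that hold binary trees, assignments, conditionals and
loops. Every operation is charged the full size of the trees that it reads and writes, so programs
and Turing machines simulate each other with polynomial overhead. -/

/-- The data of the programs: binary trees. -/
inductive Data : Type
  | nil : Data
  | node (l r : Data) : Data
  deriving DecidableEq

namespace Data

/-- The number of nodes, leaves included. -/
def size : Data → ℕ
  | nil => 1
  | node l r => l.size + r.size + 1

/-- The left subtree. -/
def hd : Data → Data
  | nil => nil
  | node l _ => l

/-- The right subtree. -/
def tl : Data → Data
  | nil => nil
  | node _ r => r

end Data

/-- The contents of the registers. -/
abbrev Store : Type := ℕ → Data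

/-- Expressions; `eq` tests whether two trees are equal. -/
inductive Expr : Type
  | reg (i : ℕ) : Expr
  | nil : Expr
  | cons (a b : Expr) : Expr
  | hd (a : Expr) : Expr
  | tl (a : Expr) : Expr
  | eq (a b : Expr) : Expr

namespace Expr

/-- The value of an expression; `nil` is the truth value false, other trees are true. -/
def eval (σ : Store) : Expr → Data
  | reg i => σ i
  | nil => .nil
  | cons a b => .node (a.eval σ) (b.eval σ)
  | hd a => (a.eval σ).hd
  | tl a => (a.eval σ).tl
  | eq a b => if a.eval σ = b.eval σ then .node .nil .nil else .nil

/-- The time to evaluate an expression: the total size of the values of all subexpressions. In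
particular copying, comparing or building a tree is charged at least the size of the tree. -/
def cost (σ : Store) : Expr → ℕ
  | reg i => (σ i).size
  | nil => 1
  | cons a b => a.cost σ + b.cost σ + (eval σ (cons a b)).size
  | hd a => a.cost σ + (eval σ (hd a)).size
  | tl a => a.cost σ + (eval σ (tl a)).size
  | eq a b => a.cost σ + b.cost σ + (eval σ (eq a b)).size

end Expr

/-- Programs. -/
inductive Prog : Type
  | assign (i : ℕ) (e : Expr) : Prog
  | seq (p q : Prog) : Prog
  | cond (e : Expr) (p q : Prog) : Prog
  | loop (e : Expr) (p : Prog) : Prog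

/-- `Exec p σ t σ'`: started in the store `σ`, the program `p` halts after time `t` in the
store `σ'`. -/
inductive Exec : Prog → Store → ℕ → Store → Prop
  | assign (i : ℕ) (e : Expr) (σ : Store) :
      Exec (.assign i e) σ (e.cost σ + 1) (Function.update σ i (e.eval σ))
  | seq {p q : Prog} {σ σ' σ'' : Store} {s t : ℕ} :
      Exec p σ s σ' → Exec q σ' t σ'' → Exec (.seq p q) σ (s + t) σ''
  | cond_true {e : Expr} {p q : Prog} {σ σ' : Store} {t : ℕ} :
      e.eval σ ≠ .nil → Exec p σ t σ' → Exec (.cond e p q) σ (e.cost σ + 1 + t) σ'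
  | cond_false {e : Expr} {p q : Prog} {σ σ' : Store} {t : ℕ} :
      e.eval σ = .nil → Exec q σ t σ' → Exec (.cond e p q) σ (e.cost σ + 1 + t) σ'
  | loop_true {e : Expr} {p : Prog} {σ σ' σ'' : Store} {s t : ℕ} :
      e.eval σ ≠ .nil → Exec p σ s σ' → Exec (.loop e p) σ' t σ'' →
      Exec (.loop e p) σ (e.cost σ + 1 + s + t) σ''
  | loop_false {e : Expr} {p : Prog} {σ : Store} :
      e.eval σ = .nil → Exec (.loop e p) σ (e.cost σ + 1) σ

/-- `p` maps the input `x` to the output `y` in time `t`: input and output are in register `0`,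
and all other registers are initially `nil`. -/
def Computes (p : Prog) (x : Data) (t : ℕ) (y : Data) : Prop :=
  ∃ σ' : Store, Exec p (Function.update (fun _ => .nil) 0 x) t σ' ∧ σ' 0 = y

/-! ### Encodings -/

/-- Natural numbers are encoded in unary. (Only gate numbers and relation names are numbers.) -/
def encNat : ℕ → Data
  | 0 => .nil
  | n + 1 => .node .nil (encNat n)

/-- Lists are encoded as iterated pairs. -/
def encList {α : Type} (enc : α → Data) : List α → Data
  | [] => .nil
  | a :: l => .node (enc a) (encList enc l)

def encBool : Bool → Data
  | false => .nil
  | true => .node .nil .nil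

def encConst (a : Const) : Data := encList encBool a

/-- A fact is the number of its relation, paired with its arguments. -/
def encFact {k : ℕ} : Fact k → Data
  | .R a => .node (encNat 0) (encConst a)
  | .S j a b => .node (encNat (j + 1)) (.node (encConst a) (encConst b))
  | .T b => .node (encNat (k + 1)) (encConst b)

/-- A gate is the number of its kind, paired with its variable or its inputs. -/
def encGate {k : ℕ} : Gate (Fact k) → Data
  | .var x => .node (encNat 0) (encFact x)
  | .not i => .node (encNat 1) (encNat i)
  | .and is => .node (encNat 2) (encList encNat is)
  | .or is => .node (encNat 3) (encList encNat is)

def encCircuit {k : ℕ} (c : Circuit (Fact k)) : Data := encList encGate c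

/-! The encodings of databases and circuits are injective. -/

theorem encNat_injective : Function.Injective encNat := by
  intro a
  induction a with
  | zero => intro b h; cases b <;> simp_all [encNat]
  | succ n ih =>
    intro b h
    cases b with
    | zero => simp [encNat] at h
    | succ m => simp [encNat] at h; rw [ih h]

theorem encList_injective {α : Type} {enc : α → Data} (he : Function.Injective enc) :
    Function.Injective (encList enc) := by
  intro a
  induction a with
  | nil => intro b h; cases b <;> simp_all [encList]
  | cons x l ih =>
    intro b h
    cases b with
    | nil => simp [encList] at h
    | cons y m => simp [encList] at h; rw [ih h.2, he h.1]

theorem encConst_injective : Function.Injective encConst :=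
  encList_injective (by intro a b; cases a <;> cases b <;> simp [encBool])

theorem encFact_injective {k : ℕ} : Function.Injective (encFact (k := k)) := by
  intro a b h
  cases a <;> cases b <;>
    simp only [encFact, Data.node.injEq, encNat_injective.eq_iff,
      encConst_injective.eq_iff] at h <;>
    simp <;> grind

theorem encCircuit_injective {k : ℕ} : Function.Injective (encCircuit (k := k)) := by
  refine encList_injective ?_
  intro a b h
  cases a <;> cases b <;>
    simp [encGate, encNat_injective.eq_iff, (encList_injective encNat_injective).eq_iff,
      encFact_injective.eq_iff] at h <;>
    simp [h]

/-- The class d-D(PTIME), in data complexity: there is a program (it may depend on the query)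
which, given any database as a list of its facts in any order, computes in time polynomial in the
size of this input a d-D that represents the lineage of the query over the database. -/
def InDDPTIME {k : ℕ} (Q : Query k) : Prop :=
  ∃ (p : Prog) (P : Polynomial ℕ), ∀ l : List (Fact k),
    ∃ (c : Circuit (Fact k)) (t : ℕ),
      Computes p (encList encFact l) t (encCircuit c) ∧
      t ≤ P.eval (encList encFact l).size ∧
      c.IsDD (l.toFinset : Set (Fact k)) ∧
      RepresentsLineage Q l.toFinset c

end HQuery

/-! The bridge between safety and circuits is the Euler characteristic of `φ`, the sum of `(-1)^|ν|`
over the valuations `ν` that satisfy `φ`.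

Safety makes it zero (`euler_satSet_of_isSafe`). If `φ` ignores a variable, flipping that variable
is a sign-reversing involution. Otherwise inclusion-exclusion over the clauses turns it into the sum
of `(-1)^|s|` over the sets `s` of clauses whose union is `V`. By Möbius inversion on the CNF
lattice this sum is `μ(0̂, 1̂)` when the clauses cover `V`, and it is empty when they do not.

Conversely, every set of valuations with Euler characteristic zero arises from the empty set by
adding disjoint edges `{ν, flip ν l}` of the hypercube and taking complements (`of_euler_eq_zero`).
Both operations preserve d-Ds: a disjoint union is a deterministic `∨`-gate, a complement is a
`¬`-gate. It remains to treat a single edge.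

The edge `{ν, flip ν l}` prescribes the truth values of all `h_{k,i}` with `i ≠ l`. Without
`h_{k,l}` the chain `R, S_1, …, S_k, T` falls apart into the atoms `0, …, l` and the atoms `l+1, …,
k+1`, which share no facts, so that a decomposable `∧`-gate joins the two halves
(`Buildable.all_but_one`). The left half contains no `T`, and its facts can be read grouped by `x`;
the right half contains no `R`, and its facts can be read grouped by `y`. In such an order an
automaton whose number of states depends only on `k` decides the queries while it reads every fact
at most once (`Buildable.scan`). Unrolling the automaton over the database gives a d-D of linear
size in the number of items read (`layered_run`).

That all this takes polynomial time on the machine model is shown by closure properties of the class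
`PT`: composition, pairing, case distinction and bounded recursion on lists. -/

namespace HQuery

/-! ### Polynomial-time functions between encoded types -/

theorem poly_eval_mono (P : Polynomial ℕ) {a b : ℕ} (hab : a ≤ b) : P.eval a ≤ P.eval b := by
  simp only [Polynomial.eval_eq_sum, Polynomial.sum]
  exact Finset.sum_le_sum fun i _ => Nat.mul_le_mul_left _ (Nat.pow_le_pow_left hab i)

theorem Data.size_pos (d : Data) : 1 ≤ d.size := by cases d <;> simp [Data.size]

theorem Expr.size_eval_le_cost (σ : Store) (e : Expr) : (e.eval σ).size ≤ e.cost σ := by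
  cases e <;> simp [Expr.eval, Expr.cost, Data.size]

/-- A program can enlarge the content of a register only by as much as its running time. -/
theorem Exec.size_le {p : Prog} {σ σ' : Store} {t : ℕ} (h : Exec p σ t σ') (j : ℕ) :
    (σ' j).size ≤ (σ j).size + t := by
  induction h with
  | assign i e σ =>
    by_cases hj : j = i
    · subst hj
      have := e.size_eval_le_cost σ
      simp; omega
    · simp [Function.update_of_ne hj]
  | seq _ _ ih1 ih2 => omega
  | cond_true _ _ ih => omega
  | cond_false _ _ ih => omega
  | loop_true _ _ _ ih1 ih2 => omega
  | loop_false _ => omega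

/-- Types whose elements are encoded as data of programs. -/
class Enc (α : Type) where
  enc : α → Data

open Enc (enc)

instance : Enc Data := ⟨id⟩
instance : Enc ℕ := ⟨encNat⟩
instance : Enc Bool := ⟨encBool⟩
instance {α β : Type} [Enc α] [Enc β] : Enc (α × β) := ⟨fun x => .node (enc x.1) (enc x.2)⟩
instance {α : Type} [Enc α] : Enc (List α) := ⟨encList enc⟩
instance {k : ℕ} : Enc (Fact k) := ⟨encFact⟩
instance {k : ℕ} : Enc (Gate (Fact k)) := ⟨encGate⟩

/-- The size of the encoding. -/
def sz {α : Type} [Enc α] (a : α) : ℕ := (enc a).size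

section
variable {α β γ δ : Type} [Enc α] [Enc β] [Enc γ] [Enc δ]

theorem sz_pos (a : α) : 1 ≤ sz a := Data.size_pos _

@[simp] theorem sz_prod (a : α) (b : β) : sz (a, b) = sz a + sz b + 1 := rfl
@[simp] theorem sz_nil : sz ([] : List α) = 1 := rfl
@[simp] theorem sz_cons (a : α) (l : List α) : sz (a :: l) = sz a + sz l + 1 := rfl
@[simp] theorem sz_nat (n : ℕ) : sz n = 2 * n + 1 := by
  induction n with
  | zero => rfl
  | succ n ih =>
    have : sz (n + 1) = 1 + sz n + 1 := rfl
    omega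

theorem sz_append (l m : List α) : sz (l ++ m) + 1 = sz l + sz m := by
  induction l with
  | nil => simp; omega
  | cons a l ih => simp; omega

theorem sz_le_of_mem {a : α} {l : List α} (h : a ∈ l) : sz a ≤ sz l := by
  induction l with
  | nil => simp at h
  | cons b l ih =>
    rcases List.mem_cons.1 h with rfl | h
    · simp; omega
    · have := ih h
      simp; omega

theorem length_lt_sz (l : List α) : l.length < sz l := by
  induction l with
  | nil => simp
  | cons a l ih => simp; omega

theorem sz_le_of_bool (b : Bool) : sz b ≤ 3 := by
  cases b <;> simp [sz, enc, encBool, Data.size]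

/-- The program `p` replaces the content of register `i`, which encodes an element of `α`, by the
encoding of its image under `f`, in time `P`, and it does not change the registers before `i`. -/
def Realizes (f : α → β) (P : Polynomial ℕ) (i : ℕ) (p : Prog) : Prop :=
  ∀ (σ : Store) (a : α), σ i = enc a → ∃ (t : ℕ) (σ' : Store), Exec p σ t σ' ∧
    σ' i = enc (f a) ∧ (∀ j < i, σ' j = σ j) ∧ t ≤ P.eval (sz a)

/-- `f` is computable in polynomial time. -/
def PT (f : α → β) : Prop := ∃ P : Polynomial ℕ, ∀ i, ∃ p : Prog, Realizes f P i p

/-- The output must be written within the running time. The resulting size bound is what makes the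
time bounds of composed programs polynomial. -/
theorem PT.sz_le {f : α → β} (hf : PT f) : ∃ P : Polynomial ℕ, ∀ a, sz (f a) ≤ P.eval (sz a) := by
  obtain ⟨P, h⟩ := hf
  obtain ⟨p, hp⟩ := h 0
  refine ⟨.X + P, fun a => ?_⟩
  obtain ⟨t, σ', he, h0, -, ht⟩ := hp (fun _ => enc a) a rfl
  have := he.size_le 0
  simp only [h0] at this
  simp only [Polynomial.eval_add, Polynomial.eval_X]
  simp only [sz] at *
  omega

/-- Covers changes of type: a nonempty list is encoded like the pair of its head and tail, and `n +
1` like the pair of `nil` and `n`. -/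
theorem PT.of_enc_eq {f : α → β} (h : ∀ a, enc (f a) = enc a) : PT f := by
  refine ⟨.X + 1, fun i => ⟨.assign i (.reg i), fun σ a ha => ⟨_, _, .assign _ _ _, ?_, ?_, ?_⟩⟩⟩
  · simp [Expr.eval, h, ha]
  · intro j hj; simp [hj.ne]
  · simp [Expr.cost, ha, sz]

theorem PT.id : PT (fun a : α => a) := .of_enc_eq fun _ => rfl

theorem PT.of_hd {f : α → β} (h : ∀ a, enc (f a) = (enc a).hd) : PT f := by
  refine ⟨2 * .X + 1, fun i =>
    ⟨.assign i (.hd (.reg i)), fun σ a ha => ⟨_, _, .assign _ _ _, ?_, ?_, ?_⟩⟩⟩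
  · simp [Expr.eval, h, ha]
  · intro j hj; simp [hj.ne]
  · have : (enc a).hd.size ≤ (enc a).size := by
      cases enc a <;> simp [Data.size, Data.hd]; omega
    simp [Expr.cost, Expr.eval, ha, sz]; omega

theorem PT.of_tl {f : α → β} (h : ∀ a, enc (f a) = (enc a).tl) : PT f := by
  refine ⟨2 * .X + 1, fun i =>
    ⟨.assign i (.tl (.reg i)), fun σ a ha => ⟨_, _, .assign _ _ _, ?_, ?_, ?_⟩⟩⟩
  · simp [Expr.eval, h, ha]
  · intro j hj; simp [hj.ne]
  · have : (enc a).tl.size ≤ (enc a).size := by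
      cases enc a <;> simp [Data.size, Data.tl]; omega
    simp [Expr.cost, Expr.eval, ha, sz]; omega

/-- The expression without registers that denotes `d`. -/
def Data.toExpr : Data → Expr
  | nil => .nil
  | node l r => .cons l.toExpr r.toExpr

theorem Data.eval_toExpr (σ : Store) (d : Data) : d.toExpr.eval σ = d := by
  induction d <;> simp_all [Data.toExpr, Expr.eval]

theorem Data.cost_toExpr (σ τ : Store) (d : Data) : d.toExpr.cost σ = d.toExpr.cost τ := by
  induction d <;> simp_all [Data.toExpr, Expr.cost, Expr.eval, Data.eval_toExpr]

theorem PT.const (b : β) : PT (fun _ : α => b) := by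
  refine ⟨.C ((enc b).toExpr.cost (fun _ => .nil) + 1), fun i =>
    ⟨.assign i (enc b).toExpr, fun σ a ha => ⟨_, _, .assign _ _ _, ?_, ?_, ?_⟩⟩⟩
  · simp [Data.eval_toExpr]
  · intro j hj; simp [hj.ne]
  · rw [Polynomial.eval_C, Data.cost_toExpr]

theorem PT.comp {g : β → γ} {f : α → β} (hg : PT g) (hf : PT f) : PT (fun a => g (f a)) := by
  obtain ⟨S, hS⟩ := hf.sz_le
  obtain ⟨P, hP⟩ := hf
  obtain ⟨Q, hQ⟩ := hg
  refine ⟨P + Q.comp S, fun i => ?_⟩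
  obtain ⟨p, hp⟩ := hP i
  obtain ⟨q, hq⟩ := hQ i
  refine ⟨.seq p q, fun σ a ha => ?_⟩
  obtain ⟨t, σ', he, h0, h1, ht⟩ := hp σ a ha
  obtain ⟨t', σ'', he', h0', h1', ht'⟩ := hq σ' _ h0
  refine ⟨_, _, .seq he he', h0', fun j hj => (h1' j hj).trans (h1 j hj), ?_⟩
  simp only [Polynomial.eval_add, Polynomial.eval_comp]
  exact add_le_add ht (ht'.trans (poly_eval_mono _ (hS a)))

/-- A program realized at index `j` leaves all registers below `j` alone. So the input survives in
register `i` while `i + 1` and `i + 2` are used for the two components. -/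
theorem PT.pair {f : α → β} {g : α → γ} (hf : PT f) (hg : PT g) : PT (fun a => (f a, g a)) := by
  obtain ⟨S, hS⟩ := hf.sz_le
  obtain ⟨T, hT⟩ := hg.sz_le
  obtain ⟨P, hP⟩ := hf
  obtain ⟨Q, hQ⟩ := hg
  -- `2 * X` pays for two copies of the input; `2 * S + 2 * T` for reading both results and writing
  -- the pair.
  refine ⟨2 * .X + P + Q + 2 * S + 2 * T + 4, fun i => ?_⟩
  obtain ⟨p, hp⟩ := hP (i + 1)
  obtain ⟨q, hq⟩ := hQ (i + 2)
  refine ⟨.seq (.assign (i + 1) (.reg i)) (.seq p (.seq (.assign (i + 2) (.reg i)) (.seq q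
    (.assign i (.cons (.reg (i + 1)) (.reg (i + 2))))))), fun σ a ha => ?_⟩
  obtain ⟨t, σ', he, h0, h1, ht⟩ := hp (Function.update σ (i + 1) (σ i)) a (by simp [ha])
  have hi : σ' i = enc a := by rw [h1 i (by omega)]; simp [ha]
  obtain ⟨t', σ'', he', h0', h1', ht'⟩ := hq (Function.update σ' (i + 2) (σ' i)) a (by simp [hi])
  have h2 : σ'' (i + 1) = enc (f a) := by rw [h1' _ (by omega)]; simp [h0]
  refine ⟨_, _, .seq (.assign _ _ _) (.seq he (.seq (.assign _ _ _) (.seq he' (.assign _ _ _)))),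
    ?_, ?_, ?_⟩
  · simp [Expr.eval, h2, h0']; rfl
  · intro j hj
    rw [Function.update_of_ne hj.ne, h1' j (by omega), Function.update_of_ne (by omega),
      h1 j (by omega), Function.update_of_ne (by omega)]
  · have := hS a
    have := hT a
    simp only [Expr.cost, Expr.eval, Data.size, h2, h0', hi, ha, Polynomial.eval_add,
      Polynomial.eval_mul, Polynomial.eval_ofNat, Polynomial.eval_X]
    simp only [sz] at *
    omega

theorem PT.fst : PT (Prod.fst : α × β → α) := .of_hd fun _ => rfl
theorem PT.snd : PT (Prod.snd : α × β → β) := .of_tl fun _ => rfl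

theorem PT.ite {c : α → Bool} {f g : α → β} (hc : PT c) (hf : PT f) (hg : PT g) :
    PT (fun a => if c a then f a else g a) := by
  obtain ⟨R, hR⟩ := hc
  obtain ⟨P, hP⟩ := hf
  obtain ⟨Q, hQ⟩ := hg
  refine ⟨.X + R + P + Q + 5, fun i => ?_⟩
  obtain ⟨r, hr⟩ := hR (i + 1)
  obtain ⟨p, hp⟩ := hP i
  obtain ⟨q, hq⟩ := hQ i
  refine ⟨.seq (.assign (i + 1) (.reg i)) (.seq r (.cond (.reg (i + 1)) p q)), fun σ a ha => ?_⟩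
  obtain ⟨t, σ', he, h0, h1, ht⟩ := hr (Function.update σ (i + 1) (σ i)) a (by simp [ha])
  have hi : σ' i = enc a := by rw [h1 i (by omega)]; simp [ha]
  have hj : ∀ j < i, σ' j = σ j := fun j hj => by
    rw [h1 j (by omega), Function.update_of_ne (by omega)]
  have hs := sz_le_of_bool (c a)
  rw [sz] at hs
  cases hca : c a
  · obtain ⟨t', σ'', he', h0', h1', ht'⟩ := hq σ' a hi
    refine ⟨_, _, .seq (.assign _ _ _) (.seq he (.cond_false ?_ he')), ?_, ?_, ?_⟩
    · simp [Expr.eval, h0, hca, enc, encBool]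
    · simp [h0', hca]
    · intro j h; rw [h1' j h, hj j h]
    · simp only [Expr.cost, h0, ha, Polynomial.eval_add, Polynomial.eval_ofNat, Polynomial.eval_X]
      simp only [sz] at *
      omega
  · obtain ⟨t', σ'', he', h0', h1', ht'⟩ := hp σ' a hi
    refine ⟨_, _, .seq (.assign _ _ _) (.seq he (.cond_true ?_ he')), ?_, ?_, ?_⟩
    · simp [Expr.eval, h0, hca, enc, encBool]
    · simp [h0', hca]
    · intro j h; rw [h1' j h, hj j h]
    · simp only [Expr.cost, h0, ha, Polynomial.eval_add, Polynomial.eval_ofNat, Polynomial.eval_X]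
      simp only [sz] at *
      omega

theorem PT.beq [DecidableEq β] (hinj : Function.Injective (enc : β → Data)) {f g : α → β}
    (hf : PT f) (hg : PT g) : PT (fun a => decide (f a = g a)) := by
  suffices h : PT (fun x : β × β => decide (x.1 = x.2)) from h.comp (hf.pair hg)
  refine ⟨3 * .X + 4, fun i => ⟨.assign i (.eq (.hd (.reg i)) (.tl (.reg i))),
    fun σ a ha => ⟨_, _, .assign _ _ _, ?_, ?_, ?_⟩⟩⟩
  · have h1 : enc a = .node (enc a.1) (enc a.2) := rfl
    by_cases h : a.1 = a.2
    · simp [Expr.eval, ha, h1, Data.hd, Data.tl, h]; rfl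
    · simp [Expr.eval, ha, h1, Data.hd, Data.tl, h, hinj.eq_iff]; rfl
  · intro j hj; simp [hj.ne]
  · have h1 : enc a = .node (enc a.1) (enc a.2) := rfl
    simp only [Expr.cost, Expr.eval, ha, sz, h1, Data.hd, Data.tl, Data.size, Polynomial.eval_add,
      Polynomial.eval_mul, Polynomial.eval_ofNat, Polynomial.eval_X]
    split_ifs <;> simp [Data.size] <;> omega

/-- Register `i` holds the parameter, `i + 1` the rest of the list, `i + 2` the accumulator, and `i
+ 3` is the workspace of the step. Since `B` bounds the accumulators after all prefixes and `M` the
list, each of the `l.length + 1` loop tests, with the iteration it may start, has the same budget.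
-/
theorem PT.foldl_loop {S : α × β × γ → γ} {P : Polynomial ℕ} {i : ℕ} {p : Prog}
    (hp : Realizes S P (i + 3) p) (x : α) (B M : ℕ) (l : List β) :
    ∀ (acc : γ) (σ : Store), σ i = enc x → σ (i + 1) = enc l → σ (i + 2) = enc acc →
      (∀ l₁ l₂, l = l₁ ++ l₂ → sz (l₁.foldl (fun c b => S (x, b, c)) acc) ≤ B) → sz l ≤ M →
      ∃ (t : ℕ) (σ' : Store),
        Exec (.loop (.reg (i + 1)) (.seq (.assign (i + 3)
          (.cons (.reg i) (.cons (.hd (.reg (i + 1))) (.reg (i + 2))))) (.seq p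
          (.seq (.assign (i + 2) (.reg (i + 3))) (.assign (i + 1) (.tl (.reg (i + 1)))))))) σ t σ' ∧
        σ' (i + 2) = enc (l.foldl (fun c b => S (x, b, c)) acc) ∧ (∀ j ≤ i, σ' j = σ j) ∧
        t ≤ (l.length + 1) *
          (2 * sz x + 10 * M + 10 * B + 10 + P.eval (sz x + M + B + 2)) := by
  induction l with
  | nil =>
    intro acc σ hx hl hacc hB hM
    refine ⟨_, _, .loop_false ?_, ?_, ?_, ?_⟩
    · simp [Expr.eval, hl, enc, encList]
    · simpa using hacc
    · intros; rfl
    · have := hM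
      simp only [Expr.cost, hl]
      simp only [sz] at *
      simp only [List.length_nil]
      omega
  | cons b l ih =>
    intro acc σ hx hl hacc hB hM
    have hl' : enc (b :: l) = .node (enc b) (enc l) := rfl
    set σ₁ := Function.update σ (i + 3) (enc (x, b, acc)) with hσ₁
    obtain ⟨t, σ₂, he, h0, h1, ht⟩ := hp σ₁ (x, b, acc) (by simp [hσ₁])
    have e0 : σ₂ i = enc x := by rw [h1 _ (by omega)]; simp [hσ₁, hx]
    have e1 : σ₂ (i + 1) = enc (b :: l) := by rw [h1 _ (by omega)]; simp [hσ₁, hl]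
    set σ₃ := Function.update σ₂ (i + 2) (enc (S (x, b, acc))) with hσ₃
    set σ₄ := Function.update σ₃ (i + 1) (enc l) with hσ₄
    obtain ⟨t', σ₅, he', h0', h1', ht'⟩ := ih (S (x, b, acc)) σ₄ (by simp [hσ₄, hσ₃, e0])
      (by simp [hσ₄]) (by simp [hσ₄, hσ₃])
      (fun l₁ l₂ h => hB (b :: l₁) l₂ (by simp [h])) (by simp at hM; omega)
    have a1 : Exec (.assign (i + 3)
          (.cons (.reg i) (.cons (.hd (.reg (i + 1))) (.reg (i + 2))))) σ
          (2 * sz x + sz (b :: l) + 3 * sz b + 3 * sz acc + 4) σ₁ := by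
      convert Exec.assign _ _ _ using 1
      · simp [Expr.cost, Expr.eval, hx, hl, hacc, hl', Data.hd, Data.size, sz]; omega
      · simp [hσ₁, Expr.eval, hx, hl, hacc, hl', Data.hd]; rfl
    have a2 : Exec (.assign (i + 2) (.reg (i + 3))) σ₂ (sz (S (x, b, acc)) + 1) σ₃ := by
      convert Exec.assign _ _ _ using 1
      · simp [Expr.cost, h0, sz]
      · simp [hσ₃, Expr.eval, h0]
    have a3 : Exec (.assign (i + 1) (.tl (.reg (i + 1)))) σ₃ (sz (b :: l) + sz l + 1) σ₄ := by
      convert Exec.assign _ _ _ using 1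
      · simp [Expr.cost, Expr.eval, hσ₃, e1, sz, hl', Data.tl]
      · simp [hσ₄, hσ₃, Expr.eval, e1, hl', Data.tl]
    refine ⟨_, _, .loop_true ?_ (.seq a1 (.seq he (.seq a2 a3))) he', ?_, ?_, ?_⟩
    · simp [Expr.eval, hl, hl']
    · simpa using h0'
    · intro j hj
      rw [h1' j hj, hσ₄, Function.update_of_ne (by omega), hσ₃, Function.update_of_ne (by omega),
        h1 j (by omega), hσ₁, Function.update_of_ne (by omega)]
    · have b1 : sz acc ≤ B := hB [] (b :: l) rfl
      have b2 : sz (S (x, b, acc)) ≤ B := hB [b] l rfl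
      have b3 : P.eval (sz (x, b, acc)) ≤ P.eval (sz x + M + B + 2) :=
        poly_eval_mono _ (by simp at hM ⊢; omega)
      have b4 : Expr.cost σ (.reg (i + 1)) = sz (b :: l) := by simp [Expr.cost, hl, sz]
      rw [b4, List.length_cons, add_mul]
      simp only [sz_cons] at *
      rw [one_mul]
      refine (add_le_add (add_le_add le_rfl (add_le_add le_rfl (add_le_add (ht.trans b3) le_rfl)))
        ht').trans ?_
      omega

/-- Bounded recursion on lists. -/
theorem PT.foldl {L : α → List β} {I : α → γ} {S : α × β × γ → γ} (hL : PT L) (hI : PT I)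
    (hS : PT S) (hB : ∃ B : Polynomial ℕ, ∀ x l₁ l₂, L x = l₁ ++ l₂ →
      sz (l₁.foldl (fun c b => S (x, b, c)) (I x)) ≤ B.eval (sz x)) :
    PT (fun x => (L x).foldl (fun c b => S (x, b, c)) (I x)) := by
  obtain ⟨B, hB⟩ := hB
  obtain ⟨M, hM⟩ := hL.sz_le
  obtain ⟨Q, hQ⟩ := hL
  obtain ⟨R, hR⟩ := hI
  obtain ⟨P, hP⟩ := hS
  refine ⟨2 * .X + 4 + Q + R + 2 * B +
    (M + 1) * (2 * .X + 10 * M + 10 * B + 10 + P.comp (.X + M + B + 2)), fun i => ?_⟩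
  obtain ⟨q, hq⟩ := hQ (i + 1)
  obtain ⟨r, hr⟩ := hR (i + 2)
  obtain ⟨p, hp⟩ := hP (i + 3)
  refine ⟨.seq (.assign (i + 1) (.reg i)) (.seq q (.seq (.assign (i + 2) (.reg i)) (.seq r
    (.seq (.loop (.reg (i + 1)) (.seq (.assign (i + 3)
          (.cons (.reg i) (.cons (.hd (.reg (i + 1))) (.reg (i + 2))))) (.seq p
          (.seq (.assign (i + 2) (.reg (i + 3))) (.assign (i + 1) (.tl (.reg (i + 1))))))))
      (.assign i (.reg (i + 2))))))), fun σ x hx => ?_⟩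
  obtain ⟨t, σ₁, he, h0, h1, ht⟩ := hq (Function.update σ (i + 1) (σ i)) x (by simp [hx])
  have hi : σ₁ i = enc x := by rw [h1 i (by omega)]; simp [hx]
  obtain ⟨t', σ₂, he', h0', h1', ht'⟩ := hr (Function.update σ₁ (i + 2) (σ₁ i)) x (by simp [hi])
  have hi' : σ₂ i = enc x := by rw [h1' i (by omega)]; simp [hi]
  have hl : σ₂ (i + 1) = enc (L x) := by rw [h1' _ (by omega)]; simp [h0]
  obtain ⟨s, σ₃, he₃, h₃, h₃', hs⟩ := foldl_loop hp x (B.eval (sz x)) (M.eval (sz x)) (L x) (I x)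
    σ₂ hi' hl h0' (hB x) (hM x)
  refine ⟨_, _, .seq (.assign _ _ _) (.seq he (.seq (.assign _ _ _) (.seq he' (.seq he₃
    (.assign _ _ _))))), ?_, ?_, ?_⟩
  · simp [Expr.eval, h₃]
  · intro j hj
    rw [Function.update_of_ne hj.ne, h₃' j hj.le, h1' j (by omega), Function.update_of_ne (by omega),
      h1 j (by omega), Function.update_of_ne (by omega)]
  · have c1 : Expr.cost σ (.reg i) = sz x := by simp [Expr.cost, hx, sz]
    have c2 : Expr.cost σ₁ (.reg i) = sz x := by simp [Expr.cost, hi, sz]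
    have c3 : Expr.cost σ₃ (.reg (i + 2)) = sz ((L x).foldl (fun c b => S (x, b, c)) (I x)) := by
      simp [Expr.cost, h₃, sz]
    have c4 := hB x (L x) [] (by simp)
    have c5 : (L x).length + 1 ≤ M.eval (sz x) + 1 :=
      Nat.succ_le_succ ((length_lt_sz _).le.trans (hM x))
    rw [c1, c2, c3]
    have := hs.trans (Nat.mul_le_mul_right _ c5)
    simp only [Polynomial.eval_add, Polynomial.eval_mul, Polynomial.eval_ofNat, Polynomial.eval_X,
      Polynomial.eval_comp, Polynomial.eval_one]
    omega

end
end HQuery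

/-! ### Polynomial-time operations on numbers and lists -/

namespace HQuery
open Enc (enc)

instance : Enc Unit := ⟨fun _ => .nil⟩

section
variable {α β γ δ : Type} [Enc α] [Enc β] [Enc γ] [Enc δ]

theorem PT.cons {f : α → β} {g : α → List β} (hf : PT f) (hg : PT g) :
    PT (fun a => f a :: g a) :=
  PT.comp (g := fun x : β × List β => x.1 :: x.2) (.of_enc_eq fun _ => rfl) (hf.pair hg)

theorem PT.succ {f : α → ℕ} (hf : PT f) : PT (fun a => f a + 1) :=
  PT.comp (g := fun x : Unit × ℕ => x.2 + 1) (.of_enc_eq fun _ => rfl)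
    ((PT.const ()).pair hf)

theorem PT.pred {f : α → ℕ} (hf : PT f) : PT (fun a => f a - 1) :=
  PT.comp (g := fun n : ℕ => n - 1) (.of_tl fun n => by cases n <;> rfl) hf

theorem PT.add_const {f : α → ℕ} (hf : PT f) (n : ℕ) : PT (fun a => f a + n) := by
  induction n with
  | zero => exact hf
  | succ n ih => exact ih.succ

theorem PT.sub_const {f : α → ℕ} (hf : PT f) (n : ℕ) : PT (fun a => f a - n) := by
  induction n with
  | zero => exact hf
  | succ n ih => exact ih.pred

theorem PT.reverse {f : α → List β} (hf : PT f) : PT (fun a => (f a).reverse) := by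
  have key : ∀ l acc : List β, l.foldl (fun c b => b :: c) acc = l.reverse ++ acc := by
    intro l
    induction l with
    | nil => simp
    | cons b l ih => intro acc; simp [ih]
  have : ∀ l : List β, sz l.reverse = sz l := by
    intro l
    induction l with
    | nil => rfl
    | cons b l ih =>
      have := sz_append l.reverse [b]
      simp at this ⊢
      omega
  have h := PT.foldl (L := fun l : List β => l) (I := fun _ => ([] : List β))
    (S := fun y : List β × β × List β => y.2.1 :: y.2.2) .id (.const _)
    (.cons (PT.fst.comp .snd) (PT.snd.comp .snd)) ⟨.X, fun l l₁ l₂ h => by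
      have h1 := sz_append l₁ l₂
      have h2 := sz_pos l₂
      simp [key, this, h]; omega⟩
  simp only [key, List.append_nil] at h
  exact h.comp hf

/-- A right fold is a left fold over the reversed list, so the size bound is needed on suffixes
instead of prefixes. -/
theorem PT.foldr {L : α → List β} {I : α → γ} {S : α × β × γ → γ} (hL : PT L) (hI : PT I)
    (hS : PT S) (hB : ∃ B : Polynomial ℕ, ∀ x l₁ l₂, L x = l₁ ++ l₂ →
      sz (l₂.foldr (fun b c => S (x, b, c)) (I x)) ≤ B.eval (sz x)) :
    PT (fun x => (L x).foldr (fun b c => S (x, b, c)) (I x)) := by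
  obtain ⟨B, hB⟩ := hB
  have h := PT.foldl hL.reverse hI hS ⟨B, fun x l₁ l₂ h => by
    rw [← List.foldr_reverse]
    refine hB x l₂.reverse l₁.reverse ?_
    rw [← List.reverse_append, ← h, List.reverse_reverse]⟩
  simpa only [List.foldl_reverse] using h

/-- Recursion on lists where every step enlarges the accumulator by a bounded size. -/
theorem PT.foldr_of_le_add {L : α → List β} {I : α → γ} {S : α × β × γ → γ} (hL : PT L)
    (hI : PT I) (hS : PT S) (hB : ∃ R : Polynomial ℕ, ∀ x, ∀ b ∈ L x, ∀ c,
      sz (S (x, b, c)) ≤ sz c + R.eval (sz x)) :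
    PT (fun x => (L x).foldr (fun b c => S (x, b, c)) (I x)) := by
  obtain ⟨R, hR⟩ := hB
  obtain ⟨P, hP⟩ := hI.sz_le
  obtain ⟨M, hM⟩ := hL.sz_le
  refine hL.foldr hI hS ⟨P + M * R, fun x l₁ l₂ h => ?_⟩
  have key : ∀ l ⊆ L x, sz (l.foldr (fun b c => S (x, b, c)) (I x)) ≤
      P.eval (sz x) + l.length * R.eval (sz x) := by
    intro l
    induction l with
    | nil => simpa using hP x
    | cons b l ih =>
      intro hl
      have h1 := ih fun a ha => hl (List.mem_cons_of_mem _ ha)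
      have h2 := hR x b (hl List.mem_cons_self) (l.foldr (fun b c => S (x, b, c)) (I x))
      rw [List.foldr_cons, List.length_cons, add_mul, one_mul]
      omega
  have h1 := key l₂ (by rw [h]; exact List.subset_append_right _ _)
  have h2 : l₂.length ≤ M.eval (sz x) := by
    have := (length_lt_sz (L x)).le.trans (hM x)
    rw [h, List.length_append] at this
    omega
  simp only [Polynomial.eval_add, Polynomial.eval_mul]
  exact h1.trans (add_le_add le_rfl (Nat.mul_le_mul_right _ h2))

theorem PT.append {f g : α → List β} (hf : PT f) (hg : PT g) : PT (fun a => f a ++ g a) := by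
  have h := PT.foldr_of_le_add (S := fun y : α × β × List β => y.2.1 :: y.2.2) hf hg
    (.cons (PT.fst.comp .snd) (PT.snd.comp .snd)) (by
      obtain ⟨R, hR⟩ := hf.sz_le
      refine ⟨R + 1, fun x b hb c => ?_⟩
      have h1 := sz_le_of_mem hb
      have h2 := hR x
      simp; omega)
  simpa using h

theorem PT.length {f : α → List β} (hf : PT f) : PT (fun a => (f a).length) := by
  have h := PT.foldr_of_le_add (S := fun y : α × β × ℕ => y.2.2 + 1) hf (.const 0)
    (.succ (PT.snd.comp .snd)) ⟨2, fun x b hb c => by simp; omega⟩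
  have key : ∀ l : List β, l.foldr (fun b c => c + 1) 0 = l.length := by
    intro l
    induction l with
    | nil => rfl
    | cons b l ih => simp [ih]
  simpa [key] using h

theorem PT.flatMap {f : α → List β} {g : α × β → List γ} (hf : PT f) (hg : PT g) :
    PT (fun a => (f a).flatMap fun b => g (a, b)) := by
  have h := PT.foldr_of_le_add (I := fun _ => ([] : List γ))
    (S := fun y : α × β × List γ => g (y.1, y.2.1) ++ y.2.2) hf (.const [])
    (.append (hg.comp (PT.fst.pair (PT.fst.comp .snd))) (PT.snd.comp .snd)) (by
      obtain ⟨R, hR⟩ := hf.sz_le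
      obtain ⟨P, hP⟩ := hg.sz_le
      refine ⟨P.comp (.X + R + 1), fun x b hb c => ?_⟩
      have h1 := sz_le_of_mem hb
      have h2 := hR x
      have h3 := hP (x, b)
      have h4 := sz_append (g (x, b)) c
      have h5 := poly_eval_mono P (a := sz (x, b)) (b := sz x + R.eval (sz x) + 1)
        (by simp; omega)
      simp only [Polynomial.eval_add, Polynomial.eval_X, Polynomial.eval_comp,
        Polynomial.eval_one]
      omega)
  convert h using 2 with a
  induction f a with
  | nil => rfl
  | cons b l ih => simp [ih]

theorem PT.mem [DecidableEq β] (hinj : Function.Injective (enc : β → Data)) {f : α → β}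
    {g : α → List β} (hf : PT f) (hg : PT g) : PT (fun a => decide (f a ∈ g a)) := by
  have h := PT.foldr_of_le_add (I := fun _ => false)
    (S := fun y : α × β × Bool => if decide (f y.1 = y.2.1) then true else y.2.2) hg (.const false)
    (.ite (.beq hinj (hf.comp .fst) (PT.fst.comp .snd)) (.const true) (PT.snd.comp .snd))
    ⟨3, fun x b hb c => by
      have := sz_le_of_bool (if decide (f x = b) then true else c)
      simp only [Polynomial.eval_ofNat]; omega⟩
  convert h using 2 with a
  induction g a with
  | nil => rfl
  | cons b l ih =>
    simp only [List.foldr_cons, ← ih, List.mem_cons]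
    by_cases h : f a = b <;> simp [h]

theorem PT.dedup [DecidableEq β] (hinj : Function.Injective (enc : β → Data)) {f : α → List β}
    (hf : PT f) : PT (fun a => (f a).dedup) := by
  have h := PT.foldr_of_le_add (I := fun _ => ([] : List β))
    (S := fun y : α × β × List β => if decide (y.2.1 ∈ y.2.2) then y.2.2 else y.2.1 :: y.2.2)
    hf (.const [])
    (.ite (.mem hinj (PT.fst.comp .snd) (PT.snd.comp .snd)) (PT.snd.comp .snd)
      (.cons (PT.fst.comp .snd) (PT.snd.comp .snd))) (by
      obtain ⟨R, hR⟩ := hf.sz_le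
      refine ⟨R + 1, fun x b hb c => ?_⟩
      have h1 := sz_le_of_mem hb
      have h2 := hR x
      simp only [Polynomial.eval_add, Polynomial.eval_one]
      split_ifs
      · omega
      · simp only [sz_cons]; omega)
  convert h using 2 with a
  induction f a with
  | nil => rfl
  | cons b l ih =>
    simp only [List.foldr_cons, ← ih]
    by_cases h : b ∈ l
    · simp [h]
    · simp [h]

/-- The list of the values of finitely many functions. -/
theorem PT.map_const {ι : Type} (s : List ι) {f : ι → α → β} (hf : ∀ i, PT (f i)) :
    PT (fun a => s.map fun i => f i a) := by
  induction s with
  | nil => exact .const []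
  | cons i s ih => exact (hf i).cons ih

/-- Distinction of finitely many cases. -/
theorem PT.cases [Finite α] (hinj : Function.Injective (enc : α → Data)) [Inhabited γ]
    {f : α × β → γ} (hf : ∀ a, PT (fun b => f (a, b))) : PT f := by
  classical
  have := Fintype.ofFinite α
  have key : ∀ s : Finset α, ∃ g : α × β → γ, PT g ∧ ∀ x, x.1 ∈ s → g x = f x := by
    intro s
    induction s using Finset.induction_on with
    | empty => exact ⟨fun _ => default, .const _, by simp⟩
    | insert a s ha ih =>
      obtain ⟨g, hg, h⟩ := ih
      refine ⟨fun x => if decide (x.1 = a) then f (a, x.2) else g x,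
        .ite (.beq hinj .fst (.const a)) ((hf a).comp .snd) hg, fun x hx => ?_⟩
      by_cases hxa : x.1 = a
      · simp [← hxa]
      · simpa [hxa] using h x (by simpa [hxa] using hx)
  obtain ⟨g, hg, h⟩ := key Finset.univ
  rwa [funext fun x => (h x (Finset.mem_univ _)).symm]

/-- The iterated extension of a list by a bounded number of new elements, which may depend on the
length of the list. -/
theorem PT.extend {L : α → List β} {I : α → List γ} {G : α × β × ℕ → List γ} (hL : PT L)
    (hI : PT I) (hG : PT G) (w : ℕ) (hw : ∀ y, (G y).length ≤ w) :
    PT (fun x => (L x).foldr (fun b c => G (x, b, c.length) ++ c) (I x)) := by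
  obtain ⟨R, hR⟩ := hG.sz_le
  obtain ⟨P, hP⟩ := hI.sz_le
  obtain ⟨M, hM⟩ := hL.sz_le
  refine PT.foldr (S := fun y : α × β × List γ => G (y.1, y.2.1, y.2.2.length) ++ y.2.2) hL hI
    (.append (hG.comp (PT.fst.pair ((PT.fst.comp .snd).pair (.length (PT.snd.comp .snd)))))
      (PT.snd.comp .snd))
    ⟨P + M * R.comp (.X + M + 2 * (P + M * .C w) + 3), fun x l₁ l₂ h => ?_⟩
  -- The size of a new block depends on the current length, so the length is bounded along with the
  -- size: it grows by at most `w` per step. The factor 2 comes from the unary encoding of the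
  -- length.
  have key : ∀ l ⊆ L x, l.length ≤ M.eval (sz x) →
      (l.foldr (fun b c => G (x, b, c.length) ++ c) (I x)).length ≤
        P.eval (sz x) + l.length * w ∧
      sz (l.foldr (fun b c => G (x, b, c.length) ++ c) (I x)) ≤ P.eval (sz x) + l.length *
        R.eval (sz x + M.eval (sz x) + 2 * (P.eval (sz x) + M.eval (sz x) * w) + 3) := by
    intro l
    induction l with
    | nil =>
      intro _ _
      exact ⟨by simpa using (length_lt_sz _).le.trans (hP x), by simpa using hP x⟩
    | cons b l ih =>
      intro hl hlen
      obtain ⟨h1, h2⟩ := ih (fun a ha => hl (List.mem_cons_of_mem _ ha))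
        (by simp at hlen; omega)
      rw [List.foldr_cons, List.length_cons, add_mul, add_mul, one_mul, one_mul]
      set c := l.foldr (fun b c => G (x, b, c.length) ++ c) (I x)
      constructor
      · have := hw (x, b, c.length)
        rw [List.length_append]
        omega
      · have h3 := sz_append (G (x, b, c.length)) c
        have h4 := hR (x, b, c.length)
        have h5 := sz_le_of_mem (hl List.mem_cons_self)
        have h6 := hM x
        have h7 : l.length * w ≤ M.eval (sz x) * w :=
          Nat.mul_le_mul_right _ (by simp at hlen; omega)
        have h8 := poly_eval_mono R (a := sz (x, b, c.length))
          (b := sz x + M.eval (sz x) + 2 * (P.eval (sz x) + M.eval (sz x) * w) + 3)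
          (by simp only [sz_prod, sz_nat]; omega)
        omega
  have h2 : l₂.length ≤ M.eval (sz x) := by
    have := (length_lt_sz (L x)).le.trans (hM x)
    rw [h, List.length_append] at this
    omega
  have h1 := (key l₂ (by rw [h]; exact List.subset_append_right _ _) h2).2
  simp only [Polynomial.eval_add, Polynomial.eval_mul, Polynomial.eval_comp, Polynomial.eval_X,
    Polynomial.eval_C, Polynomial.eval_ofNat]
  exact h1.trans (add_le_add le_rfl (Nat.mul_le_mul_right _ h2))

end

theorem PT.computes {α β : Type} [Enc α] [Enc β] {f : α → β} (hf : PT f) :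
    ∃ (p : Prog) (P : Polynomial ℕ), ∀ a, ∃ t, Computes p (enc a) t (enc (f a)) ∧
      t ≤ P.eval (sz a) := by
  obtain ⟨P, h⟩ := hf
  obtain ⟨p, hp⟩ := h 0
  refine ⟨p, P, fun a => ?_⟩
  obtain ⟨t, σ', he, h0, -, ht⟩ := hp (Function.update (fun _ => .nil) 0 (enc a)) a (by simp)
  exact ⟨t, ⟨σ', he, h0⟩, ht⟩

end HQuery

namespace HQuery
open Enc (enc)

/-! ### Building d-Ds -/

namespace Circuit
variable {X : Type}

/-- The Boolean function captured by a gate on top of the circuit `c`. -/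
def gateValue (ν : Set X) (c : Circuit X) : Gate X → Prop
  | .var x => x ∈ ν
  | .not i => ¬ value ν c i
  | .and is => ∀ i ∈ is, value ν c i
  | .or is => ∃ i ∈ is, value ν c i

/-- The variables of a gate on top of the circuit `c`. -/
def gateVars (c : Circuit X) : Gate X → Set X
  | .var x => {x}
  | .not i => vars c i
  | .and is => ⋃ i ∈ is, vars c i
  | .or is => ⋃ i ∈ is, vars c i

theorem value_cons_length (ν : Set X) (g : Gate X) (c : Circuit X) :
    value ν (g :: c) c.length = gateValue ν c g := by
  cases g <;> simp [value, gateValue]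

theorem vars_cons_length (g : Gate X) (c : Circuit X) :
    vars (g :: c) c.length = gateVars c g := by
  cases g <;> simp [vars, gateVars]

/-- Gates are numbered from the bottom, so new gates on top neither renumber nor affect the old
ones. -/
theorem value_append (ν : Set X) (gs c : Circuit X) {i : ℕ} (hi : i < c.length) :
    value ν (gs ++ c) i = value ν c i := by
  induction gs with
  | nil => rfl
  | cons g gs ih =>
    have : i ≠ (gs ++ c).length := by simp; omega
    rw [List.cons_append, ← ih]
    cases g <;> simp only [value, if_neg this]

theorem vars_append (gs c : Circuit X) {i : ℕ} (hi : i < c.length) :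
    vars (gs ++ c) i = vars c i := by
  induction gs with
  | nil => rfl
  | cons g gs ih =>
    have : i ≠ (gs ++ c).length := by simp; omega
    rw [List.cons_append, ← ih]
    cases g <;> simp only [vars, if_neg this]

theorem value_cons (ν : Set X) (g : Gate X) (c : Circuit X) {i : ℕ} (hi : i < c.length) :
    value ν (g :: c) i = value ν c i := value_append ν [g] c hi

theorem vars_cons (g : Gate X) (c : Circuit X) {i : ℕ} (hi : i < c.length) :
    vars (g :: c) i = vars c i := vars_append [g] c hi

/-- The gate `g` may be put on top of the d-D `c` over the variables `V`. -/
def GateOK (V : Set X) (c : Circuit X) : Gate X → Prop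
  | .var x => x ∈ V
  | .not i => i < c.length
  | .and is => (∀ i ∈ is, i < c.length) ∧ is.Pairwise fun i j => Disjoint (vars c i) (vars c j)
  | .or is => (∀ i ∈ is, i < c.length) ∧
      is.Pairwise fun i j => ∀ ν : Set X, ¬ (value ν c i ∧ value ν c j)

/-- All gates of `c` fulfil the conditions on d-Ds over the variables `V`. -/
def CircOK (V : Set X) : Circuit X → Prop
  | [] => True
  | g :: c => GateOK V c g ∧ CircOK V c

theorem GateOK.lt {V : Set X} {c : Circuit X} {g : Gate X} (h : GateOK V c g) :
    ∀ i ∈ g.inputs, i < c.length := by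
  cases g with
  | var x => simp [Gate.inputs]
  | not i => simpa [Gate.inputs] using (show i < c.length from h)
  | and is => exact h.1
  | or is => exact h.1

theorem GateOK.value_append {V : Set X} {c : Circuit X} {g : Gate X} (h : GateOK V c g)
    (gs : Circuit X) (ν : Set X) : gateValue ν (gs ++ c) g = gateValue ν c g := by
  have h := h.lt
  cases g with
  | var x => rfl
  | not i => simp only [gateValue, Circuit.value_append ν gs c (h i (by simp [Gate.inputs]))]
  | and is =>
    exact propext (forall₂_congr fun i hi => by rw [Circuit.value_append ν gs c (h i hi)])
  | or is =>
    exact propext (exists_congr fun i => and_congr_right fun hi => by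
      rw [Circuit.value_append ν gs c (h i hi)])

theorem GateOK.vars_append {V : Set X} {c : Circuit X} {g : Gate X} (h : GateOK V c g)
    (gs : Circuit X) : gateVars (gs ++ c) g = gateVars c g := by
  have h := h.lt
  cases g with
  | var x => rfl
  | not i => exact Circuit.vars_append gs c (h i (by simp [Gate.inputs]))
  | and is => exact Set.iUnion₂_congr fun i hi => Circuit.vars_append gs c (h i hi)
  | or is => exact Set.iUnion₂_congr fun i hi => Circuit.vars_append gs c (h i hi)

theorem GateOK.append {V : Set X} {c : Circuit X} {g : Gate X} (h : GateOK V c g)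
    (gs : Circuit X) : GateOK V (gs ++ c) g := by
  have hl : c.length ≤ (gs ++ c).length := by simp
  cases g with
  | var x => exact h
  | not i => exact lt_of_lt_of_le h hl
  | and is =>
    refine ⟨fun i hi => (h.1 i hi).trans_le hl, h.2.imp_of_mem fun hi hj hij => ?_⟩
    rwa [Circuit.vars_append gs c (h.1 _ hi), Circuit.vars_append gs c (h.1 _ hj)]
  | or is =>
    refine ⟨fun i hi => (h.1 i hi).trans_le hl, h.2.imp_of_mem fun hi hj hij ν => ?_⟩
    rw [Circuit.value_append ν gs c (h.1 _ hi), Circuit.value_append ν gs c (h.1 _ hj)]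
    exact hij ν

theorem CircOK.gateOK {V : Set X} {c : Circuit X} (hc : CircOK V c) {g : Gate X}
    {rest : Circuit X} (h : (g :: rest) <:+ c) : GateOK V rest g := by
  induction c with
  | nil => simp at h
  | cons g' c ih =>
    rcases List.suffix_cons_iff.1 h with h | h
    · obtain ⟨rfl, rfl⟩ := List.cons.inj h
      exact hc.1
    · exact ih hc.2 h

/-- The recursive conditions `CircOK`, suited to building a circuit gate by gate, contain the
conditions on all suffixes. -/
theorem CircOK.isDD {V : Set X} {c : Circuit X} (hc : CircOK V c) (h0 : c ≠ []) : c.IsDD V := by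
  refine ⟨⟨h0, fun g rest h => (hc.gateOK h).lt, fun x hx => ?_⟩,
    fun is rest h => (hc.gateOK h).2, fun is rest h => (hc.gateOK h).2⟩
  obtain ⟨s, t, rfl⟩ := List.append_of_mem hx
  exact hc.gateOK (List.suffix_append _ _)

/-- Several independent gates on top of a circuit. -/
theorem CircOK.append {V : Set X} {c gs : Circuit X} (hc : CircOK V c)
    (h : ∀ g ∈ gs, GateOK V c g) :
    CircOK V (gs ++ c) ∧ ∀ i (hi : i < gs.length),
      (∀ ν, value ν (gs ++ c) (c.length + gs.length - 1 - i) = gateValue ν c gs[i]) ∧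
      vars (gs ++ c) (c.length + gs.length - 1 - i) = gateVars c gs[i] := by
  induction gs with
  | nil => exact ⟨hc, by simp⟩
  | cons g gs ih =>
    obtain ⟨h1, h2⟩ := ih fun g hg => h g (List.mem_cons_of_mem _ hg)
    have hg := h g List.mem_cons_self
    refine ⟨⟨hg.append gs, h1⟩, fun i hi => ?_⟩
    cases i with
    | zero =>
      -- The head of the list is the top gate, hence has the largest number; numbers decrease along
      -- the list.
      have : c.length + (g :: gs).length - 1 - 0 = (gs ++ c).length := by simp; omega
      rw [this, List.cons_append, vars_cons_length]
      refine ⟨fun ν => ?_, ?_⟩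
      · rw [value_cons_length, hg.value_append]; rfl
      · rw [hg.vars_append]; rfl
    | succ i =>
      have hi' : i < gs.length := by simpa using hi
      have e : c.length + (g :: gs).length - 1 - (i + 1) = c.length + gs.length - 1 - i := by
        simp; omega
      have hl : c.length + gs.length - 1 - i < (gs ++ c).length := by simp; omega
      rw [e, List.cons_append, vars_cons _ _ hl]
      refine ⟨fun ν => ?_, ?_⟩
      · rw [value_cons _ _ _ hl, (h2 i hi').1]; rfl
      · rw [(h2 i hi').2]; rfl

/-- The gates `g 0, …, g (m - 1)` on top of a circuit. -/
theorem CircOK.append_finRange {V : Set X} {c : Circuit X} (hc : CircOK V c) {m : ℕ}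
    {g : Fin m → Gate X} (h : ∀ q, GateOK V c (g q)) :
    CircOK V ((List.finRange m).map g ++ c) ∧ ∀ q : Fin m,
      (∀ ν, value ν ((List.finRange m).map g ++ c) (c.length + m - 1 - q) =
        gateValue ν c (g q)) ∧
      vars ((List.finRange m).map g ++ c) (c.length + m - 1 - q) = gateVars c (g q) := by
  obtain ⟨h1, h2⟩ := hc.append (gs := (List.finRange m).map g) (by simpa using h)
  refine ⟨h1, fun q => ?_⟩
  simpa using h2 q (by simp)

/-! ### Unrolling a finite automaton into a d-D -/

variable {A : Type} {m : ℕ}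

/-- The circuit `c` is a d-D over `V` whose last `m` gates, in reverse order, capture the Boolean
functions `f` and depend only on variables in `W`. -/
structure Layered (V : Set X) (c : Circuit X) (f : Fin m → Set X → Prop) (W : Set X) : Prop where
  ok : CircOK V c
  le : m ≤ c.length
  value_iff : ∀ (q : Fin m) ν, c.value ν (c.length - 1 - q) ↔ f q ν
  vars_subset : ∀ q : Fin m, c.vars (c.length - 1 - q) ⊆ W

/-- Gates for the acceptance condition of an automaton. -/
def acceptGates (acc : Fin m → Bool) : List (Gate X) :=
  (List.finRange m).map fun q => if acc q then .and [] else .or []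

theorem layered_accept {V : Set X} {c : Circuit X} (hc : CircOK V c) (acc : Fin m → Bool) :
    Layered V (acceptGates acc ++ c) (fun q _ => acc q = true) ∅ := by
  obtain ⟨h1, h2⟩ := hc.append_finRange (m := m) (g := fun q => if acc q then .and [] else .or [])
    (fun q => by split_ifs <;> simp [GateOK])
  have hl : (acceptGates acc ++ c).length = c.length + m := by simp [acceptGates]; omega
  refine ⟨h1, by omega, fun q ν => ?_, fun q => ?_⟩
  · rw [hl, acceptGates, (h2 q).1]
    split_ifs with h <;> simp [gateValue, h]
  · rw [hl, acceptGates, (h2 q).2]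
    split_ifs <;> simp [gateVars]

/-- Gates for one step of an automaton with the transition function `δ`. An item consists of a
letter, a variable and the information whether the variable is read; otherwise its value is taken to
be false. The number `N` is the number of gates below. -/
def stepGates (δ : A → Fin m → Bool → Fin m) (y : A × Bool × X) (N : ℕ) : List (Gate X) :=
  if y.2.1 then
    (List.finRange m).map (fun q => .or [N + 2 + m - 1 - q, N + 2 + m + m - 1 - q]) ++
    ((List.finRange m).map (fun q => .and [N + 1, N - 1 - (δ y.1 q false : ℕ)]) ++
    ((List.finRange m).map (fun q => .and [N, N - 1 - (δ y.1 q true : ℕ)]) ++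
    [.not N, .var y.2.2]))
  else (List.finRange m).map fun q => .or [N - 1 - (δ y.1 q false : ℕ)]

theorem length_stepGates_le (δ : A → Fin m → Bool → Fin m) (y : A × Bool × X) (N : ℕ) :
    (stepGates δ y N).length ≤ 3 * m + 2 := by
  rw [stepGates]
  split_ifs <;> simp <;> omega

/-- Nothing is read, so one-input `∨`-gates merely copy the gates of the successor states; the
copies restore the layout with one gate per state on top. -/
theorem Layered.step_absent {V : Set X} {c : Circuit X} {f : Fin m → Set X → Prop} {W : Set X}
    (hc : Layered V c f W) (δ : A → Fin m → Bool → Fin m) (a : A) (x : X) :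
    Layered V (stepGates δ (a, false, x) c.length ++ c) (fun q => f (δ a q false)) W := by
  have hlt : ∀ q : Fin m, c.length - 1 - (q : ℕ) < c.length := fun q => by
    have := q.2; have := hc.le; omega
  obtain ⟨h1, h2⟩ := hc.ok.append_finRange
    (m := m) (g := fun q => .or [c.length - 1 - (δ a q false : ℕ)]) (fun q => by simp [GateOK, hlt])
  have hs : stepGates δ (a, false, x) c.length =
      (List.finRange m).map fun q => .or [c.length - 1 - (δ a q false : ℕ)] := by
    simp [stepGates]
  have hl : (stepGates δ (a, false, x) c.length ++ c).length = c.length + m := by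
    simp [hs]; omega
  refine ⟨by rw [hs]; exact h1, by omega, fun q ν => ?_, fun q => ?_⟩
  · rw [hl, hs, (h2 q).1]
    simp [gateValue, hc.value_iff]
  · rw [hl, hs, (h2 q).2]
    simpa [gateVars] using hc.vars_subset _

open Classical in
-- Shannon expansion: the new function for `q` is `x ∧ f (δ a q true)` or `¬x ∧ f (δ a q false)`.
-- The disjuncts disagree on `x`, which gives determinism, and `x ∉ W` gives decomposability. From
-- the bottom, the new gates are `x` (number `N`), `¬x` (number `N + 1`), and three blocks of `m`
-- gates: conjunctions with `x`, conjunctions with `¬x`, disjunctions.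
theorem Layered.step_present {V : Set X} {c : Circuit X} {f : Fin m → Set X → Prop} {W : Set X}
    (hc : Layered V c f W) (δ : A → Fin m → Bool → Fin m) (a : A) {x : X} (hx : x ∈ V)
    (hxW : x ∉ W) :
    Layered V (stepGates δ (a, true, x) c.length ++ c)
      (fun q ν => f (δ a q (decide (x ∈ ν))) ν) (insert x W) := by
  have hle := hc.le
  set N := c.length with hN
  have hlt : ∀ q : Fin m, N - 1 - (q : ℕ) < N := fun q => by have := q.2; omega
  have hval : ∀ (q : Fin m) ν, value ν c (N - 1 - q) ↔ f q ν := hc.value_iff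
  set c₀ : Circuit X := .not N :: .var x :: c with hc₀
  have l₀ : c₀.length = N + 2 := by simp [hc₀, hN]
  have ok₀ : CircOK V c₀ := ⟨by simp [GateOK, hN], hx, hc.ok⟩
  have val₀ : ∀ ν, ∀ i < N, value ν c₀ i = value ν c i := fun ν i hi =>
    value_append ν [.not N, .var x] c hi
  have var₀ : ∀ i < N, vars c₀ i = vars c i := fun i hi => vars_append [.not N, .var x] c hi
  have valN : ∀ ν, value ν c₀ N = (x ∈ ν) := fun ν => by
    rw [hc₀, value_cons _ _ _ (by simp [hN]), hN, value_cons_length]; rfl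
  have varN : vars c₀ N = {x} := by
    rw [hc₀, vars_cons _ _ (by simp [hN]), hN, vars_cons_length]; rfl
  have valN1 : ∀ ν, value ν c₀ (N + 1) = (x ∉ ν) := fun ν => by
    have : N + 1 = (Gate.var x :: c).length := by simp [hN]
    rw [hc₀, this, value_cons_length, gateValue, hN, value_cons_length]; rfl
  have varN1 : vars c₀ (N + 1) = {x} := by
    have : N + 1 = (Gate.var x :: c).length := by simp [hN]
    rw [hc₀, this, vars_cons_length, gateVars, hN, vars_cons_length]; rfl
  have hdisj : ∀ q : Fin m, Disjoint {x} (vars c₀ (N - 1 - (q : ℕ))) := fun q => by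
    rw [var₀ _ (hlt q), Set.disjoint_singleton_left]
    exact fun h => hxW (hc.vars_subset q h)
  -- the conjunctions for the value true
  obtain ⟨ok₁, v₁⟩ := ok₀.append_finRange (m := m) (g := fun q => .and [N, N - 1 - (δ a q true : ℕ)])
    (fun q => by
      have := hlt (δ a q true)
      refine ⟨by simp [l₀]; omega, ?_⟩
      simpa [varN] using hdisj (δ a q true))
  set c₁ := (List.finRange m).map (fun q => .and [N, N - 1 - (δ a q true : ℕ)]) ++ c₀ with hc₁
  have l₁ : c₁.length = N + 2 + m := by simp [hc₁, l₀]; omega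
  -- the conjunctions for the value false
  obtain ⟨ok₂, v₂⟩ := ok₁.append_finRange (m := m) (g := fun q => .and [N + 1, N - 1 - (δ a q false : ℕ)])
    (fun q => by
      have := hlt (δ a q false)
      refine ⟨by simp [l₁]; omega, ?_⟩
      have e1 : vars c₁ (N + 1) = {x} := by rw [hc₁, vars_append _ _ (by omega), varN1]
      have e2 := vars_append ((List.finRange m).map
        (fun q => .and [N, N - 1 - (δ a q true : ℕ)])) c₀
        (i := N - 1 - (δ a q false : ℕ)) (by omega)
      rw [← hc₁] at e2
      simpa [e1, e2] using hdisj (δ a q false))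
  set c₂ := (List.finRange m).map (fun q => .and [N + 1, N - 1 - (δ a q false : ℕ)]) ++ c₁
    with hc₂
  have l₂ : c₂.length = N + 2 + m + m := by simp [hc₂, l₁]; omega
  have t₂ : ∀ q : Fin m, (∀ ν, value ν c₂ (N + 2 + m - 1 - q) ↔ x ∈ ν ∧ f (δ a q true) ν) ∧
      vars c₂ (N + 2 + m - 1 - q) ⊆ insert x W := fun q => by
    have hq := q.2
    have hlt' := hlt (δ a q true)
    refine ⟨fun ν => ?_, ?_⟩
    · rw [hc₂, value_append _ _ _ (by omega), ← l₀, (v₁ q).1]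
      simp [gateValue, valN, val₀ ν _ hlt', hval]
    · rw [hc₂, vars_append _ _ (by omega), ← l₀, (v₁ q).2]
      have := (hc.vars_subset (δ a q true)).trans (Set.subset_insert x W)
      rw [← var₀ _ hlt'] at this
      simpa [gateVars, varN, Set.insert_subset_iff] using this
  have f₂ : ∀ q : Fin m, (∀ ν, value ν c₂ (N + 2 + m + m - 1 - q) ↔ x ∉ ν ∧ f (δ a q false) ν) ∧
      vars c₂ (N + 2 + m + m - 1 - q) ⊆ insert x W := fun q => by
    have hlt' := hlt (δ a q false)
    refine ⟨fun ν => ?_, ?_⟩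
    · rw [← l₁, (v₂ q).1]
      have e1 : value ν c₁ (N + 1) = (x ∉ ν) := by rw [hc₁, value_append _ _ _ (by omega), valN1]
      have e2 : value ν c₁ (N - 1 - (δ a q false : ℕ)) = value ν c (N - 1 - (δ a q false : ℕ)) := by
        rw [hc₁, value_append _ _ _ (by omega), val₀ ν _ hlt']
      simp [gateValue, e1, e2, hval]
    · rw [← l₁, (v₂ q).2]
      have e1 : vars c₁ (N + 1) = {x} := by rw [hc₁, vars_append _ _ (by omega), varN1]
      have e2 : vars c₁ (N - 1 - (δ a q false : ℕ)) = vars c (N - 1 - (δ a q false : ℕ)) := by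
        rw [hc₁, vars_append _ _ (by omega), var₀ _ hlt']
      have := (hc.vars_subset (δ a q false)).trans (Set.subset_insert x W)
      rw [← e2] at this
      simpa [gateVars, e1, Set.insert_subset_iff] using this
  obtain ⟨ok₃, v₃⟩ := ok₂.append_finRange
    (m := m) (g := fun q => .or [N + 2 + m - 1 - q, N + 2 + m + m - 1 - q])
    (fun q => by
      have hq := q.2
      refine ⟨by simp [l₂]; omega, ?_⟩
      simp only [List.pairwise_cons, List.mem_singleton, forall_eq, List.not_mem_nil,
        false_implies, implies_true, List.Pairwise.nil, and_true, (t₂ q).1, (f₂ q).1]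
      exact fun ν h => h.2.1 h.1.1)
  have hs : stepGates δ (a, true, x) N ++ c =
      (List.finRange m).map (fun q => .or [N + 2 + m - 1 - q, N + 2 + m + m - 1 - q]) ++ c₂ := by
    simp [stepGates, hc₂, hc₁, hc₀]
  have l₃ : (stepGates δ (a, true, x) N ++ c).length = c₂.length + m := by simp [hs]; omega
  refine ⟨by rw [hs]; exact ok₃, by omega, fun q ν => ?_, fun q => ?_⟩
  · rw [l₃, hs, (v₃ q).1]
    simp only [gateValue, List.mem_cons, List.not_mem_nil, or_false, exists_eq_or_imp,
      exists_eq_left, (t₂ q).1, (f₂ q).1]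
    by_cases h : x ∈ ν <;> simp [h]
  · rw [l₃, hs, (v₃ q).2]
    refine Set.iUnion₂_subset fun i hi => ?_
    simp only [List.mem_cons, List.not_mem_nil, or_false] at hi
    rcases hi with rfl | rfl
    exacts [(t₂ q).2, (f₂ q).2]

open Classical in
/-- The state of an automaton after it has read a list of items. -/
noncomputable def run {Q : Type} (δ : A → Q → Bool → Q) (ν : Set X) (q : Q)
    (ys : List (A × Bool × X)) : Q :=
  ys.foldl (fun q y => δ y.1 q (y.2.1 && decide (y.2.2 ∈ ν))) q

/-- The variables that are read. -/
def readVars (ys : List (A × Bool × X)) : List X := (ys.filter (·.2.1)).map (·.2.2)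

/-- The automaton is unrolled backwards from acceptance: the top layer holds, for each state `q`,
the condition that the remaining items lead from `q` to acceptance. That no variable is read twice
provides the freshness needed for decomposability. -/
theorem layered_run {V : Set X} {c : Circuit X} (hc : CircOK V c) (δ : A → Fin m → Bool → Fin m)
    (acc : Fin m → Bool) (ys : List (A × Bool × X)) (hV : ∀ x ∈ readVars ys, x ∈ V)
    (hys : (readVars ys).Nodup) :
    Layered V (ys.foldr (fun y c => stepGates δ y c.length ++ c) (acceptGates acc ++ c))
      (fun q ν => acc (run δ ν q ys) = true) {x | x ∈ readVars ys} := by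
  induction ys with
  | nil => simpa [run, readVars] using layered_accept hc acc
  | cons y ys ih =>
    obtain ⟨a, b, x⟩ := y
    cases b
    · have e : readVars ((a, false, x) :: ys) = readVars ys := by simp [readVars]
      rw [e] at hV hys ⊢
      simpa [run] using (ih hV hys).step_absent δ a x
    · have e : readVars ((a, true, x) :: ys) = x :: readVars ys := by simp [readVars]
      rw [e] at hV hys ⊢
      have := (ih (fun x hx => hV x (List.mem_cons_of_mem _ hx)) (List.nodup_cons.1 hys).2
        ).step_present δ a (hV x List.mem_cons_self) (List.nodup_cons.1 hys).1
      have e' : {z | z ∈ x :: readVars ys} = insert x {z | z ∈ readVars ys} := by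
        ext; simp
      rw [e']
      simpa [run] using this

end Circuit
end HQuery

namespace HQuery
open Enc (enc)

/-! ### Queries whose lineages can be built in polynomial time -/

section
variable {α β : Type} [Enc α] [Enc β] {k : ℕ}

theorem PT.of_data {f : α → Data} {g : α → β} (hf : PT f) (h : ∀ a, enc (g a) = f a) : PT g := by
  obtain ⟨P, hP⟩ := hf
  refine ⟨P, fun i => ?_⟩
  obtain ⟨p, hp⟩ := hP i
  refine ⟨p, fun σ a ha => ?_⟩
  obtain ⟨t, σ', h1, h2, h3⟩ := hp σ a ha
  exact ⟨t, σ', h1, h2.trans (h a).symm, h3⟩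

theorem PT.enc {f : α → β} (hf : PT f) : PT (fun a => Enc.enc (f a)) :=
  PT.comp (g := fun b : β => Enc.enc b) (.of_enc_eq fun _ => rfl) hf

theorem PT.node {f g : α → Data} (hf : PT f) (hg : PT g) : PT (fun a => Data.node (f a) (g a)) :=
  PT.comp (g := fun x : Data × Data => Data.node x.1 x.2) (.of_enc_eq fun _ => rfl) (hf.pair hg)

theorem PT.gate_var {f : α → Fact k} (hf : PT f) : PT (fun a => Gate.var (f a)) :=
  .of_data (.node (.const (encNat 0)) hf.enc) fun _ => rfl

theorem PT.gate_not {f : α → ℕ} (hf : PT f) : PT (fun a => (Gate.not (f a) : Gate (Fact k))) :=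
  .of_data (.node (.const (encNat 1)) hf.enc) fun _ => rfl

theorem PT.gate_and {f : α → List ℕ} (hf : PT f) :
    PT (fun a => (Gate.and (f a) : Gate (Fact k))) :=
  .of_data (.node (.const (encNat 2)) hf.enc) fun _ => rfl

theorem PT.gate_or {f : α → List ℕ} (hf : PT f) :
    PT (fun a => (Gate.or (f a) : Gate (Fact k))) :=
  .of_data (.node (.const (encNat 3)) hf.enc) fun _ => rfl

/-- There are finitely many letters; once the letter is fixed, the gates form a list of constant
length for each value of the read flag, with numbers at fixed offsets from `N`. -/
theorem PT.stepGates {A : Type} [Enc A] [Finite A] (hinj : Function.Injective (Enc.enc : A → Data))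
    {m : ℕ} (δ : A → Fin m → Bool → Fin m) {f : α → A × Bool × Fact k} {g : α → ℕ} (hf : PT f)
    (hg : PT g) : PT (fun a => Circuit.stepGates δ (f a) (g a)) := by
  suffices h : PT (fun y : A × (Bool × Fact k × ℕ) =>
      Circuit.stepGates δ (y.1, y.2.1, y.2.2.1) y.2.2.2) from
    h.comp ((PT.fst.comp hf).pair ((PT.fst.comp (PT.snd.comp hf)).pair
      ((PT.snd.comp (PT.snd.comp hf)).pair hg)))
  refine PT.cases hinj fun a => .ite .fst ?_ ?_
  · have hN : PT (fun y : Bool × Fact k × ℕ => y.2.2) := PT.snd.comp .snd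
    refine .append (.map_const _ fun q => .gate_or (.cons ?_ (.cons ?_ (.const []))))
      (.append (.map_const _ fun q => .gate_and (.cons (hN.add_const 1) (.cons ?_ (.const []))))
      (.append (.map_const _ fun q => .gate_and (.cons hN (.cons ?_ (.const []))))
      (.cons (.gate_not hN) (.cons (.gate_var (PT.fst.comp .snd)) (.const [])))))
    · exact (((hN.add_const 2).add_const m).sub_const 1).sub_const q
    · exact ((((hN.add_const 2).add_const m).add_const m).sub_const 1).sub_const q
    · exact (hN.sub_const 1).sub_const (δ a q false)
    · exact (hN.sub_const 1).sub_const (δ a q true)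
  · exact .map_const _ fun q => .gate_or (.cons
      (((PT.snd.comp .snd).sub_const 1).sub_const (δ a q false)) (.const []))

end

open Circuit
open Classical in
/-- The sub-database of the true facts. -/
noncomputable def restrict {k : ℕ} (l : List (Fact k)) (ν : Set (Fact k)) : Database k :=
  l.toFinset.filter (· ∈ ν)

/-- There is a polynomial-time function which, given a database, puts gates on top of a d-D such
that the new output gate represents the lineage of `Q` over the database and depends only on facts
in `U`. -/
def Buildable {k : ℕ} (U : Set (Fact k)) (Q : Query k) : Prop :=
  ∃ f : List (Fact k) × Circuit (Fact k) → Circuit (Fact k), PT f ∧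
    ∀ (l : List (Fact k)) (c : Circuit (Fact k)), CircOK {x | x ∈ l} c →
      (∃ gs, f (l, c) = gs ++ c) ∧ f (l, c) ≠ [] ∧ CircOK {x | x ∈ l} (f (l, c)) ∧
      (∀ ν, (f (l, c)).output ν ↔ Q (restrict l ν)) ∧
      vars (f (l, c)) ((f (l, c)).length - 1) ⊆ U

section
variable {k : ℕ} {U U' : Set (Fact k)} {Q Q' : Query k}

theorem output_cons {X : Type} (ν : Set X) (g : Gate X) (c : Circuit X) :
    output ν (g :: c) = gateValue ν c g := by
  rw [output, List.length_cons, Nat.add_sub_cancel, value_cons_length]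

theorem Buildable.congr (h : Buildable U Q) (hQ : ∀ D, Q D ↔ Q' D) : Buildable U Q' := by
  rwa [← funext fun D => propext (hQ D)]

theorem Buildable.not (h : Buildable U Q) : Buildable U fun D => ¬ Q D := by
  obtain ⟨f, hf, h⟩ := h
  refine ⟨fun x => .not ((f x).length - 1) :: f x, .cons (.gate_not (hf.length.sub_const 1)) hf,
    fun l c hc => ?_⟩
  dsimp only
  obtain ⟨⟨gs, h1⟩, h2, h3, h4, h5⟩ := h l c hc
  have := List.length_pos_of_ne_nil h2
  refine ⟨⟨_ :: gs, by rw [h1]; rfl⟩, by simp, ⟨?_, h3⟩, fun ν => ?_, ?_⟩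
  · simp only [GateOK]; omega
  · rw [output_cons, ← h4]; rfl
  · rw [List.length_cons, Nat.add_sub_cancel, vars_cons_length]; exact h5

/-- Two builders one after the other. -/
theorem Buildable.both (h : Buildable U Q) (h' : Buildable U' Q') :
    ∃ f₁ f₂ : List (Fact k) × Circuit (Fact k) → Circuit (Fact k), PT f₁ ∧ PT f₂ ∧
    ∀ (l : List (Fact k)) (c : Circuit (Fact k)), CircOK {x | x ∈ l} c →
      (∃ gs, f₂ (l, c) = gs ++ c) ∧ CircOK {x | x ∈ l} (f₂ (l, c)) ∧
      (f₁ (l, c)).length - 1 < (f₂ (l, c)).length ∧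
      (f₂ (l, c)).length - 1 < (f₂ (l, c)).length ∧
      (∀ ν, (f₂ (l, c)).value ν ((f₁ (l, c)).length - 1) ↔
        Q (restrict l ν)) ∧
      (∀ ν, (f₂ (l, c)).value ν ((f₂ (l, c)).length - 1) ↔
        Q' (restrict l ν)) ∧
      vars (f₂ (l, c)) ((f₁ (l, c)).length - 1) ⊆ U ∧
      vars (f₂ (l, c)) ((f₂ (l, c)).length - 1) ⊆ U' := by
  obtain ⟨f, hf, h⟩ := h
  obtain ⟨f', hf', h'⟩ := h'
  -- The second builder works on top of the circuit of the first, whose output gate keeps its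
  -- number.
  refine ⟨f, fun x => f' (x.1, f x), hf, hf'.comp (PT.fst.pair hf), fun l c hc => ?_⟩
  dsimp only
  obtain ⟨⟨gs, h1⟩, h2, h3, h4, h5⟩ := h l c hc
  obtain ⟨⟨gs', h1'⟩, h2', h3', h4', h5'⟩ := h' l (f (l, c)) h3
  have p := List.length_pos_of_ne_nil h2
  have p' := List.length_pos_of_ne_nil h2'
  have hlt : (f (l, c)).length - 1 < (f (l, c)).length := by omega
  refine ⟨⟨gs' ++ gs, by rw [h1', h1, List.append_assoc]⟩, h3', ?_, by omega, ?_, ?_, ?_,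
    h5'⟩
  · simp only [h1', List.length_append]; omega
  · intro ν
    rw [h1', value_append _ _ _ hlt]
    exact h4 ν
  · intro ν
    exact h4' ν
  · rw [h1', vars_append _ _ hlt]
    exact h5

/-- Disjointness of `U` and `U'` makes the new gate decomposable. The bound on the variables is then
given up: conjunctions are only needed for single hypercube edges, below all unions and complements.
-/
theorem Buildable.and (h : Buildable U Q) (h' : Buildable U' Q') (hU : Disjoint U U') :
    Buildable Set.univ fun D => Q D ∧ Q' D := by
  obtain ⟨f₁, f₂, hf₁, hf₂, H⟩ := h.both h'
  refine ⟨fun x => .and [(f₁ x).length - 1, (f₂ x).length - 1] :: f₂ x, .cons (.gate_and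
    (.cons (hf₁.length.sub_const 1) (.cons (hf₂.length.sub_const 1) (.const [])))) hf₂,
    fun l c hc => ?_⟩
  dsimp only
  obtain ⟨⟨gs, h1⟩, h2, h3, h4, h5, h6, h7, h8⟩ := H l c hc
  refine ⟨⟨_ :: gs, by rw [List.cons_append, ← h1]⟩, by simp, ⟨⟨?_, ?_⟩, h2⟩, fun ν => ?_,
    Set.subset_univ _⟩
  · simp only [List.mem_cons, List.not_mem_nil, or_false]
    rintro i (rfl | rfl)
    exacts [h3, h4]
  · simpa using hU.mono h7 h8
  · rw [output_cons]
    simp only [gateValue, List.mem_cons, List.not_mem_nil, or_false, forall_eq_or_imp, forall_eq,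
      h5, h6]

/-- Mutually exclusive queries make the new gate deterministic, whatever facts they share. -/
theorem Buildable.or (h : Buildable U Q) (h' : Buildable U' Q') (hQ : ∀ D, ¬ (Q D ∧ Q' D)) :
    Buildable Set.univ fun D => Q D ∨ Q' D := by
  obtain ⟨f₁, f₂, hf₁, hf₂, H⟩ := h.both h'
  refine ⟨fun x => .or [(f₁ x).length - 1, (f₂ x).length - 1] :: f₂ x, .cons (.gate_or
    (.cons (hf₁.length.sub_const 1) (.cons (hf₂.length.sub_const 1) (.const [])))) hf₂,
    fun l c hc => ?_⟩
  dsimp only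
  obtain ⟨⟨gs, h1⟩, h2, h3, h4, h5, h6, h7, h8⟩ := H l c hc
  refine ⟨⟨_ :: gs, by rw [List.cons_append, ← h1]⟩, by simp, ⟨⟨?_, ?_⟩, h2⟩, fun ν => ?_,
    Set.subset_univ _⟩
  · simp only [List.mem_cons, List.not_mem_nil, or_false]
    rintro i (rfl | rfl)
    exacts [h3, h4]
  · simp only [List.pairwise_cons, List.mem_singleton, forall_eq, List.not_mem_nil,
      false_implies, implies_true, List.Pairwise.nil, and_true, h5, h6]
    exact fun ν => hQ _
  · rw [output_cons]
    simp only [gateValue, List.mem_cons, List.not_mem_nil, or_false, exists_eq_or_imp,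
      exists_eq_left, h5, h6]

theorem Buildable.false : Buildable (k := k) Set.univ fun _ => False := by
  refine ⟨fun x => .or [] :: x.2, .cons (.const _) .snd, fun l c hc =>
    ⟨⟨[_], rfl⟩, by simp, ⟨by simp [GateOK], hc⟩, fun ν => ?_, Set.subset_univ _⟩⟩
  simp [output_cons, gateValue]

theorem Buildable.inDDPTIME (h : Buildable U Q) : InDDPTIME Q := by
  obtain ⟨f, hf, h⟩ := h
  obtain ⟨p, P, hp⟩ := (hf.comp (PT.id.pair (.const []))).computes
  refine ⟨p, P, fun l => ?_⟩
  obtain ⟨t, h1, h2⟩ := hp l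
  obtain ⟨-, h4, h5, h6, -⟩ := h l [] trivial
  have e : ((l.toFinset : Finset (Fact k)) : Set (Fact k)) = {x | x ∈ l} := by ext; simp
  refine ⟨f (l, []), t, h1, h2, e ▸ h5.isDD h4, fun D' hD' => (h6 D').trans ?_⟩
  have : restrict l D' = D' := by
    ext x
    simpa [restrict] using fun hx => by simpa using hD' hx
  rw [this]

theorem run_equiv {A S X : Type} {m : ℕ} (e : S ≃ Fin m) (δ : A → S → Bool → S) (ν : Set X)
    (ys : List (A × Bool × X)) : ∀ q,
    run (fun a i b => e (δ a (e.symm i) b)) ν (e q) ys = e (run δ ν q ys) := by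
  induction ys with
  | nil => intro q; rfl
  | cons y ys ih =>
    intro q
    simp only [run, List.foldl_cons, Equiv.symm_apply_apply] at ih ⊢
    exact ih _

/-- Queries that are decided by a finite automaton which reads every fact at most once. -/
theorem Buildable.of_automaton {A S : Type} [Enc A] [Finite A] [Finite S]
    (hinj : Function.Injective (enc : A → Data)) (δ : A → S → Bool → S) (acc : S → Prop) (q₀ : S)
    {items : List (Fact k) → List (A × Bool × Fact k)} (hit : PT items)
    (hmem : ∀ l, ∀ x ∈ readVars (items l), x ∈ l ∧ x ∈ U) (hnd : ∀ l, (readVars (items l)).Nodup)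
    (hQ : ∀ l ν, acc (run δ ν q₀ (items l)) ↔ Q (restrict l ν)) :
    Buildable U Q := by
  obtain ⟨m, ⟨e⟩⟩ := Finite.exists_equiv_fin S
  classical
  set δ' : A → Fin m → Bool → Fin m := fun a i b => e (δ a (e.symm i) b) with hδ
  set acc' : Fin m → Bool := fun i => decide (acc (e.symm i)) with hacc
  set F : List (Fact k) × Circuit (Fact k) → Circuit (Fact k) := fun x =>
    (items x.1).foldr (fun y c => stepGates δ' y c.length ++ c) (acceptGates acc' ++ x.2) with hF
  have hFPT : PT F := by
    refine PT.extend (G := fun y => stepGates δ' y.2.1 y.2.2) (hit.comp .fst)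
      ((PT.const _).append .snd) (.stepGates hinj _ (PT.fst.comp .snd) (PT.snd.comp .snd))
      (3 * m + 2) fun y => length_stepGates_le _ _ _
  -- The gate of the initial state need not be the top one; a one-input `∨`-gate makes it the
  -- output.
  refine ⟨fun x => .or [(F x).length - 1 - (e q₀ : ℕ)] :: F x,
    .cons (.gate_or (.cons ((hFPT.length.sub_const 1).sub_const _) (.const []))) hFPT,
    fun l c hc => ?_⟩
  dsimp only
  have H := layered_run hc δ' acc' (items l) (fun x hx => (hmem l x hx).1) (hnd l)
  change Layered _ (F (l, c)) _ _ at H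
  have hpre : ∀ ys : List (A × Bool × Fact k), ∃ gs,
      ys.foldr (fun y c => stepGates δ' y c.length ++ c) (acceptGates acc' ++ c) = gs ++ c := by
    intro ys
    induction ys with
    | nil => exact ⟨_, rfl⟩
    | cons y ys ih =>
      obtain ⟨gs, h⟩ := ih
      exact ⟨_, by rw [List.foldr_cons, h, ← List.append_assoc]⟩
  obtain ⟨gs, hgs⟩ := hpre (items l)
  change F (l, c) = _ at hgs
  have h1 := H.le
  have h2 := (e q₀).2
  refine ⟨⟨_ :: gs, by rw [List.cons_append, ← hgs]⟩, by simp, ⟨⟨?_, by simp⟩, H.ok⟩,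
    fun ν => ?_, ?_⟩
  · simp; omega
  · rw [output_cons]
    simp only [gateValue, List.mem_cons, List.not_mem_nil, or_false, exists_eq_left, H.value_iff]
    rw [hδ, run_equiv]
    simpa [hacc] using hQ l ν
  · rw [List.length_cons, Nat.add_sub_cancel, vars_cons_length]
    refine Set.iUnion₂_subset fun i hi => ?_
    rw [List.mem_singleton] at hi
    subst hi
    exact (H.vars_subset _).trans fun x hx => (hmem l x hx).2

end
end HQuery

namespace HQuery
open Enc (enc)
open Circuit

/-! ### Scanning a database -/

section
variable {k : ℕ}

/-- The constants of a fact. -/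
def Fact.consts : Fact k → List Const
  | .R a => [a]
  | .S _ a b => [a, b]
  | .T b => [b]

theorem PT.fact_consts : PT (Fact.consts : Fact k → List Const) := by
  have htag : PT (fun x : Fact k => match x with
      | .R _ => 0 | .S j _ _ => (j : ℕ) + 1 | .T _ => k + 1) := .of_hd fun x => by cases x <;> rfl
  have harg : PT (fun x : Fact k => (Enc.enc x).tl) := .of_tl fun _ => rfl
  have hhd : PT Data.hd := .of_hd fun _ => rfl
  have htl : PT Data.tl := .of_tl fun _ => rfl
  refine .of_data (.ite (.beq encNat_injective htag (.const 0)) (harg.node (.const .nil))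
    (.ite (.beq encNat_injective htag (.const (k + 1))) (harg.node (.const .nil))
      ((hhd.comp harg).node ((htl.comp harg).node (.const .nil))))) fun x => ?_
  cases x with
  | R a => rfl
  | S j a b =>
    have : (j : ℕ) ≠ k := by omega
    simp [this]; rfl
  | T b => simp; rfl

theorem atom_zero (x y : Const) : atom k 0 x y = .R x := rfl

theorem atom_last (x y : Const) : atom k (k + 1) x y = .T y := by simp [atom]

theorem atom_mid {j : ℕ} (h0 : j ≠ 0) (hj : j - 1 < k) (x y : Const) :
    atom k j x y = .S ⟨j - 1, hj⟩ x y := by simp [atom, h0, hj]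

/-- A fact determines its position in the chain of atoms. The exceptions are there because `T(y)`
forgets `x` and `R(x)` forgets `y`. -/
theorem atom_inj {i j : ℕ} (hi : i ≤ k + 1) (hj : j ≤ k + 1) {x y x' y' : Const}
    (h : atom k i x y = atom k j x' y') :
    i = j ∧ (i ≠ k + 1 → x = x') ∧ (i ≠ 0 → y = y') := by
  simp only [atom] at h
  split_ifs at h <;> simp at h <;> first | omega | (simp [h]; omega)

theorem PT.atom (j : Fin (k + 2)) : PT (fun x : Const × Const => HQuery.atom k j x.1 x.2) := by
  by_cases h0 : (j : ℕ) = 0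
  · exact .of_data ((PT.const (encNat 0)).node PT.fst.enc) fun x => by simp [h0, HQuery.atom]; rfl
  · by_cases hj : (j : ℕ) - 1 < k
    · exact .of_data ((PT.const (encNat (j - 1 + 1))).node PT.id.enc) fun x => by
        rw [atom_mid h0 hj]; rfl
    · have : (j : ℕ) = k + 1 := by omega
      exact .of_data ((PT.const (encNat (k + 1))).node PT.snd.enc) fun x => by
        rw [this, atom_last]; rfl

/-- The letters that the automata read: forget the facts that were seen, forget all facts but those
of one relation, or read a fact with the given number. -/
inductive Letter (k : ℕ) : Type
  | clear
  | flush
  | atom (j : Fin (k + 2))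

instance : Enc (Letter k) where
  enc
    | .clear => encNat 0
    | .flush => encNat 1
    | .atom j => encNat (j + 2)

theorem Letter.enc_injective : Function.Injective (enc : Letter k → Data) := by
  intro a b h
  cases a <;> cases b <;> simp [enc, encNat_injective.eq_iff] at h <;> simp
  exact Fin.ext h

instance : Finite (Letter k) :=
  Finite.of_surjective (α := Option (Option (Fin (k + 2))))
    (fun | none => .clear | some none => .flush | some (some j) => .atom j)
    fun | .clear => ⟨none, rfl⟩ | .flush => ⟨some none, rfl⟩ | .atom j => ⟨some (some j), rfl⟩

/-- The indices `i` such that `P` contains both atoms of `h_{k,i}`. -/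
def hits (P : Set (Fin (k + 2))) : Set (Fin (k + 1)) := {i | i.castSucc ∈ P ∧ i.succ ∈ P}

/-- The transitions of the automaton. Its states consist of the indices `i` for which `h_{k,i}` has
been found to be true and of the numbers of the true atoms for the current constants. -/
def scanStep (o : Fin (k + 2)) : Letter k → Set (Fin (k + 1)) × Set (Fin (k + 2)) → Bool →
    Set (Fin (k + 1)) × Set (Fin (k + 2))
  | .clear, q, _ => (q.1, ∅)
  | .flush, q, _ => (q.1 ∪ hits q.2, q.2 ∩ {o})
  | .atom j, q, b => (q.1, if b then insert j q.2 else q.2)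

/-- The atom with number `j`, whose arguments are exchanged if `s` is true. -/
def swapAtom (k : ℕ) (s : Bool) (j : Fin (k + 2)) (u v : Const) : Fact k :=
  if s then atom k j v u else atom k j u v

theorem PT.swapAtom (s : Bool) (j : Fin (k + 2)) {α : Type} [Enc α] {f g : α → Const} (hf : PT f)
    (hg : PT g) : PT (fun x => HQuery.swapAtom k s j (f x) (g x)) := by
  cases s
  · exact (PT.atom j).comp (hf.pair hg)
  · exact (PT.atom j).comp (hg.pair hf)

/-- The items for the pairs with first constant `u` and second constant `v`. -/
def innerItems (l : List (Fact k)) (s : Bool) (o : Fin (k + 2)) (J : List (Fin (k + 2)))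
    (u v : Const) : List (Letter k × Bool × Fact k) :=
  J.map (fun j => (.atom j, decide (swapAtom k s j u v ∈ l), swapAtom k s j u v)) ++
    [(.flush, false, swapAtom k s o u u)]

/-- The items for the first constant `u`. -/
def outerItems (l : List (Fact k)) (cs : List Const) (s : Bool) (o : Fin (k + 2))
    (J : List (Fin (k + 2))) (u : Const) : List (Letter k × Bool × Fact k) :=
  (.clear, false, swapAtom k s o u u) ::
    (.atom o, decide (swapAtom k s o u u ∈ l), swapAtom k s o u u) ::
      cs.flatMap (innerItems l s o J u)

/-- The constants of a database. -/
def constList (l : List (Fact k)) : List Const := (l.flatMap Fact.consts).dedup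

/-- The items of the automaton: for every constant `u`, the atom with number `o`, and for every
constant `v` the atoms with numbers in `J`. -/
def scanItems (s : Bool) (o : Fin (k + 2)) (J : List (Fin (k + 2))) (l : List (Fact k)) :
    List (Letter k × Bool × Fact k) :=
  (constList l).flatMap (outerItems l (constList l) s o J)

theorem PT.constList : PT (constList : List (Fact k) → List Const) :=
  .dedup encConst_injective (.flatMap .id (PT.fact_consts.comp .snd))

theorem PT.scanItems (s : Bool) (o : Fin (k + 2)) (J : List (Fin (k + 2))) :
    PT (scanItems s o J : List (Fact k) → _) := by
  have hitem : ∀ {α : Type} [Enc α] (j : Fin (k + 2)) {l : α → List (Fact k)} {f g : α → Const},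
      PT l → PT f → PT g → PT (fun x => ((Letter.atom j : Letter k),
        decide (HQuery.swapAtom k s j (f x) (g x) ∈ l x), HQuery.swapAtom k s j (f x) (g x))) :=
    fun j _ _ _ hl hf hg => (PT.const _).pair
      ((PT.mem encFact_injective (.swapAtom s j hf hg) hl).pair (.swapAtom s j hf hg))
  have hinner : PT (fun x : (List (Fact k) × Const) × Const =>
      innerItems x.1.1 s o J x.1.2 x.2) :=
    .append (.map_const _ fun j => hitem j (PT.fst.comp .fst) (PT.snd.comp .fst) .snd)
      (.cons ((PT.const _).pair ((PT.const _).pair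
        (.swapAtom s o (PT.snd.comp .fst) (PT.snd.comp .fst)))) (.const []))
  have houter : PT (fun x : List (Fact k) × Const =>
      outerItems x.1 (HQuery.constList x.1) s o J x.2) :=
    .cons ((PT.const _).pair ((PT.const _).pair (.swapAtom s o .snd .snd)))
      (.cons (hitem o .fst .snd .snd) (.flatMap (PT.constList.comp .fst) hinner))
  exact .flatMap .constList houter

theorem run_append {A S X : Type} (δ : A → S → Bool → S) (ν : Set X) (q : S)
    (ys zs : List (A × Bool × X)) : run δ ν q (ys ++ zs) = run δ ν (run δ ν q ys) zs :=
  List.foldl_append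

variable (l : List (Fact k)) (ν : Set (Fact k)) (s : Bool) (o : Fin (k + 2))
  (J : List (Fin (k + 2)))

theorem mem_restrict {x : Fact k} : x ∈ restrict l ν ↔ x ∈ l ∧ x ∈ ν := by simp [restrict]

theorem run_atoms (H : Set (Fin (k + 1))) (u v : Const) : ∀ P : Set (Fin (k + 2)),
    run (scanStep o) ν (H, P) (J.map fun j =>
      ((.atom j : Letter k), decide (swapAtom k s j u v ∈ l), swapAtom k s j u v)) =
    (H, P ∪ {j | j ∈ J ∧ swapAtom k s j u v ∈ restrict l ν}) := by
  induction J with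
  | nil => intro P; simp [run]
  | cons j J ih =>
    intro P
    rw [List.map_cons, run, List.foldl_cons]
    simp only [scanStep]
    refine (ih _).trans ?_
    ext i
    · simp
    · simp only [Set.mem_union, Set.mem_ofPred_eq, List.mem_cons, mem_restrict,
        Bool.and_eq_true, decide_eq_true_eq]
      split_ifs with h
      · grind
      · grind

/-- The numbers of the true atoms for the constants `u` and `v`. -/
def trueAtoms (u v : Const) : Set (Fin (k + 2)) :=
  {j | j = o ∧ swapAtom k s o u u ∈ restrict l ν} ∪
    {j | j ∈ J ∧ swapAtom k s j u v ∈ restrict l ν}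

variable {o J} (ho : o ∉ J)
include ho

/-- Between two inner blocks the memory holds at most the outer atom `o`. As `o ∉ J`, the final
flush of a block restores exactly the set `P` with which the block started. -/
theorem run_inner {P : Set (Fin (k + 2))} (hP : P ⊆ {o}) (u : Const) (vs : List Const) :
    ∀ H : Set (Fin (k + 1)),
    run (scanStep o) ν (H, P) (vs.flatMap (innerItems l s o J u)) =
    (H ∪ {i | ∃ v ∈ vs, i ∈ hits (P ∪ {j | j ∈ J ∧ swapAtom k s j u v ∈ restrict l ν})}, P) := by
  induction vs with
  | nil => intro H; simp [run]
  | cons v vs ih =>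
    intro H
    rw [List.flatMap_cons, run_append, innerItems, run_append, run_atoms]
    have : run (scanStep o) ν (H, P ∪ {j | j ∈ J ∧ swapAtom k s j u v ∈ restrict l ν})
        [((.flush : Letter k), false, swapAtom k s o u u)] =
        (H ∪ hits (P ∪ {j | j ∈ J ∧ swapAtom k s j u v ∈ restrict l ν}), P) := by
      simp only [run, List.foldl_cons, List.foldl_nil, scanStep]
      congr 1
      ext j
      simp only [Set.mem_inter_iff, Set.mem_union, Set.mem_ofPred_eq, Set.mem_singleton_iff]
      constructor
      · rintro ⟨h | h, rfl⟩
        · exact h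
        · exact absurd h.1 ho
      · exact fun h => ⟨.inl h, hP h⟩
    rw [this, ih]
    congr 1
    ext i
    simp [or_assoc]

/-- The initial memory `P` is arbitrary because each outer block begins by clearing it. -/
theorem run_outer (vs us : List Const) : ∀ H P,
    (run (scanStep o) ν (H, P) (us.flatMap (outerItems l vs s o J))).1 =
      H ∪ {i | ∃ u ∈ us, ∃ v ∈ vs, i ∈ hits (trueAtoms l ν s o J u v)} := by
  induction us with
  | nil => intro H P; simp [run]
  | cons u us ih =>
    intro H P
    rw [List.flatMap_cons, run_append]
    have : run (scanStep o) ν (H, P) (outerItems l vs s o J u) =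
        (H ∪ {i | ∃ v ∈ vs, i ∈ hits (trueAtoms l ν s o J u v)},
          {j | j = o ∧ swapAtom k s o u u ∈ restrict l ν}) := by
      have h := run_inner l ν s ho (P := {j | j = o ∧ swapAtom k s o u u ∈ restrict l ν})
        (fun j hj => hj.1) u vs H
      simp only [trueAtoms]
      rw [← h]
      simp only [outerItems, run, List.foldl_cons, scanStep]
      congr 2
      ext j
      by_cases h1 : swapAtom k s o u u ∈ l <;> by_cases h2 : swapAtom k s o u u ∈ ν <;>
        simp [mem_restrict, h1, h2]
    rw [this, ih, Set.union_assoc]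
    congr 1
    ext i
    simp

/-! ### No fact is read twice, and the automaton evaluates the queries `h_{k,i}` -/

omit ho
variable (hos : o = if s then Fin.last (k + 1) else 0)
  (hJ : ∀ j ∈ J, (j : ℕ) ≠ 0 ∧ (j : ℕ) ≠ k + 1)

include hos hJ in
theorem outer_not_mem : o ∉ J := fun h => by
  have := hJ o h
  cases s <;> simp [hos] at this

include hos in
theorem swapAtom_outer (u v : Const) : swapAtom k s o u v = swapAtom k s o u u := by
  subst hos
  cases s
  · rfl
  · simp [swapAtom, atom_last]

theorem swapAtom_inj {i j : Fin (k + 2)} {u v u' v' : Const}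
    (h : swapAtom k s i u v = swapAtom k s j u' v') :
    i = j ∧ ((i : ℕ) ≠ 0 → (i : ℕ) ≠ k + 1 → u = u' ∧ v = v') := by
  cases s
  · obtain ⟨h1, h2, h3⟩ := atom_inj (Nat.lt_succ_iff.1 i.2) (Nat.lt_succ_iff.1 j.2) h
    exact ⟨Fin.ext h1, fun a b => ⟨h2 b, h3 a⟩⟩
  · obtain ⟨h1, h2, h3⟩ := atom_inj (Nat.lt_succ_iff.1 i.2) (Nat.lt_succ_iff.1 j.2) h
    exact ⟨Fin.ext h1, fun a b => ⟨h3 a, h2 b⟩⟩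

include hos in
theorem swapAtom_outer_inj {u u' : Const} (h : swapAtom k s o u u = swapAtom k s o u' u') :
    u = u' := by
  subst hos
  cases s
  · simpa [swapAtom, atom_zero] using h
  · simpa [swapAtom, atom_last] using h

/-- The items for clearing and flushing carry a dummy fact, which is never read. -/
theorem readVars_cons_false {A X : Type} (a : A) (x : X) (ys : List (A × Bool × X)) :
    readVars ((a, false, x) :: ys) = readVars ys := rfl

theorem mem_readVars {A X : Type} {x : X} {ys : List (A × Bool × X)} :
    x ∈ readVars ys ↔ ∃ a, (a, true, x) ∈ ys := by simp [readVars]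

theorem readVars_flatMap {A B X : Type} (us : List B) (f : B → List (A × Bool × X)) :
    readVars (us.flatMap f) = us.flatMap fun u => readVars (f u) := by
  simp [readVars, List.filter_flatMap, List.map_flatMap]

theorem mem_readVars_innerItems {u v : Const} {x : Fact k} :
    x ∈ readVars (innerItems l s o J u v) ↔ ∃ j ∈ J, x = swapAtom k s j u v ∧ x ∈ l := by
  simp only [mem_readVars, innerItems, List.mem_append, List.mem_map, List.mem_singleton]
  constructor
  · rintro ⟨a, ⟨j, hj, h⟩ | h⟩
    · simp only [Prod.mk.injEq, decide_eq_true_eq] at h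
      exact ⟨j, hj, h.2.2.symm, h.2.2 ▸ h.2.1⟩
    · simp at h
  · rintro ⟨j, hj, rfl, h⟩
    exact ⟨.atom j, .inl ⟨j, hj, by simp [h]⟩⟩

theorem mem_readVars_outerItems {vs : List Const} {u : Const} {x : Fact k} :
    x ∈ readVars (outerItems l vs s o J u) ↔ x ∈ l ∧
      (x = swapAtom k s o u u ∨ ∃ v ∈ vs, ∃ j ∈ J, x = swapAtom k s j u v) := by
  rw [outerItems, readVars_cons_false]
  have e : ∀ ys, x ∈ readVars (((.atom o : Letter k), decide (swapAtom k s o u u ∈ l),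
      swapAtom k s o u u) :: ys) ↔ (x ∈ l ∧ x = swapAtom k s o u u) ∨ x ∈ readVars ys := by
    intro ys
    simp only [mem_readVars, List.mem_cons, exists_or, Prod.mk.injEq]
    refine or_congr_left ⟨?_, ?_⟩
    · rintro ⟨a, -, h1, rfl⟩
      exact ⟨by simpa using h1, rfl⟩
    · rintro ⟨h, rfl⟩
      exact ⟨_, rfl, by simp [h], rfl⟩
  rw [e, readVars_flatMap]
  simp only [List.mem_flatMap, mem_readVars_innerItems]
  grind

include hos hJ in
-- The atoms with numbers in `J` are binary, so such a fact determines its number and both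
-- constants; the outer atom has a number outside `J`.
theorem nodup_readVars_outerItems (hnd : J.Nodup) {vs : List Const} (hvs : vs.Nodup) (u : Const) :
    (readVars (outerItems l vs s o J u)).Nodup := by
  have hinner : (readVars (vs.flatMap (innerItems l s o J u))).Nodup := by
    rw [readVars_flatMap, List.nodup_flatMap]
    refine ⟨fun v _ => ?_, hvs.imp fun {v v'} hv => ?_⟩
    · have : readVars (innerItems l s o J u v) =
          (J.filter fun j => decide (swapAtom k s j u v ∈ l)).map fun j => swapAtom k s j u v := by
        simp only [readVars, innerItems, List.filter_append, List.map_append, List.filter_map,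
          List.map_map]
        simp [Function.comp_def]
      rw [this]
      exact (hnd.filter _).map fun i j h => (swapAtom_inj s h).1
    · intro x hx hx'
      obtain ⟨j, hj, rfl, -⟩ := (mem_readVars_innerItems ..).1 hx
      obtain ⟨j', hj', h, -⟩ := (mem_readVars_innerItems ..).1 hx'
      exact hv ((swapAtom_inj s h).2 (hJ j hj).1 (hJ j hj).2).2
  rw [outerItems, readVars_cons_false]
  by_cases h : swapAtom k s o u u ∈ l
  · have : readVars (((.atom o : Letter k), decide (swapAtom k s o u u ∈ l),
        swapAtom k s o u u) :: vs.flatMap (innerItems l s o J u)) =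
        swapAtom k s o u u :: readVars (vs.flatMap (innerItems l s o J u)) := by
      simp [readVars, h]
    rw [this, List.nodup_cons]
    refine ⟨fun hx => ?_, hinner⟩
    rw [readVars_flatMap, List.mem_flatMap] at hx
    obtain ⟨v, -, hx⟩ := hx
    obtain ⟨j, hj, h, -⟩ := (mem_readVars_innerItems ..).1 hx
    obtain ⟨rfl, -⟩ := swapAtom_inj s h
    exact outer_not_mem s hos hJ hj
  · simpa [h, readVars_cons_false] using hinner

theorem nodup_constList : (constList l).Nodup := List.nodup_dedup _

include hos hJ in
theorem nodup_readVars_scanItems (hnd : J.Nodup) : (readVars (scanItems s o J l)).Nodup := by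
  rw [scanItems, readVars_flatMap, List.nodup_flatMap]
  refine ⟨fun u _ => nodup_readVars_outerItems l s hos hJ hnd (nodup_constList l) u,
    (nodup_constList l).imp fun {u u'} hu x hx hx' => hu ?_⟩
  have ho := outer_not_mem s hos hJ
  obtain ⟨-, hx⟩ := (mem_readVars_outerItems ..).1 hx
  obtain ⟨-, hx'⟩ := (mem_readVars_outerItems ..).1 hx'
  rcases hx with rfl | ⟨v, -, j, hj, rfl⟩
  · rcases hx' with h | ⟨v', -, j', hj', h⟩
    · exact swapAtom_outer_inj s hos h
    · exact absurd ((swapAtom_inj s h).1 ▸ hj') ho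
  · rcases hx' with h | ⟨v', -, j', hj', h⟩
    · exact absurd ((swapAtom_inj s h).1 ▸ hj) ho
    · exact ((swapAtom_inj s h).2 (hJ j hj).1 (hJ j hj).2).1

/-- As `k ≥ 1`, one of two consecutive atoms is binary and mentions both witnesses. Hence it
suffices to scan the constants of the database. -/
theorem mem_constList (hk : 1 ≤ k) (i : Fin (k + 1)) {x y : Const} (h : atom k i x y ∈ l)
    (h' : atom k (i + 1) x y ∈ l) : x ∈ constList l ∧ y ∈ constList l := by
  have key : ∀ j : Fin k, Fact.S j x y ∈ l → x ∈ constList l ∧ y ∈ constList l := by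
    intro j hj
    simp only [constList, List.mem_dedup, List.mem_flatMap]
    exact ⟨⟨_, hj, by simp [Fact.consts]⟩, ⟨_, hj, by simp [Fact.consts]⟩⟩
  have := i.2
  by_cases hi : (i : ℕ) = 0
  · rw [atom_mid (by omega) (by omega)] at h'
    exact key _ h'
  · rw [atom_mid hi (by omega)] at h
    exact key _ h

include hos hJ in
/-- The automaton computes the truth values of the queries `h_{k,i}` whose atoms it reads. -/
theorem run_scanItems (hk : 1 ≤ k) (i : Fin (k + 1)) (hi : i.castSucc ∈ o :: J)
    (hi' : i.succ ∈ o :: J) :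
    i ∈ (run (scanStep o) ν (∅, ∅) (scanItems s o J l)).1 ↔ h k i (restrict l ν) := by
  have ho := outer_not_mem s hos hJ
  have key : ∀ u v, i ∈ hits (trueAtoms l ν s o J u v) ↔
      swapAtom k s i.castSucc u v ∈ restrict l ν ∧ swapAtom k s i.succ u v ∈ restrict l ν := by
    have : ∀ j ∈ o :: J, ∀ u v, j ∈ trueAtoms l ν s o J u v ↔
        swapAtom k s j u v ∈ restrict l ν := by
      intro j hj u v
      simp only [trueAtoms, Set.mem_union, Set.mem_ofPred_eq]
      by_cases h : j = o
      · subst h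
        simp [ho, swapAtom_outer s hos u v]
      · simp [h, (List.mem_cons.1 hj).resolve_left h]
    intro u v
    exact and_congr (this _ hi u v) (this _ hi' u v)
  rw [scanItems, run_outer l ν s ho]
  simp only [Set.empty_union, Set.mem_ofPred_eq, key, h]
  constructor
  · rintro ⟨u, -, v, -, h1, h2⟩
    cases s
    · exact ⟨u, v, h1, h2⟩
    · exact ⟨v, u, h1, h2⟩
  · rintro ⟨x, y, h1, h2⟩
    obtain ⟨hx, hy⟩ := mem_constList l hk i ((mem_restrict ..).1 h1).1 ((mem_restrict ..).1 h2).1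
    cases s
    · exact ⟨x, hx, y, hy, h1, h2⟩
    · exact ⟨y, hy, x, hx, h1, h2⟩

include hos hJ in
/-- The conjunction of the queries `h_{k,i}`, or their negations, for the indices `i` such that both
atoms of `h_{k,i}` are scanned. -/
theorem Buildable.scan (hk : 1 ≤ k) (hnd : J.Nodup) (θ : Finset (Fin (k + 1))) :
    Buildable {x | ∃ j ∈ o :: J, ∃ u v, x = atom k j u v} fun D =>
      ∀ i : Fin (k + 1), i.castSucc ∈ o :: J → i.succ ∈ o :: J → (h k i D ↔ i ∈ θ) := by
  refine Buildable.of_automaton Letter.enc_injective (scanStep o)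
    (fun q => ∀ i : Fin (k + 1), i.castSucc ∈ o :: J → i.succ ∈ o :: J → (i ∈ q.1 ↔ i ∈ θ)) (∅, ∅)
    (PT.scanItems s o J) (fun l x hx => ?_)
    (fun l => nodup_readVars_scanItems l s hos hJ hnd) (fun l ν => ?_)
  · have hsw : ∀ j ∈ o :: J, ∀ u v, ∃ j' ∈ o :: J, ∃ u' v',
        swapAtom k s j u v = atom k j' u' v' := by
      intro j hj u v
      cases s
      · exact ⟨j, hj, u, v, rfl⟩
      · exact ⟨j, hj, v, u, rfl⟩
    rw [scanItems, readVars_flatMap, List.mem_flatMap] at hx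
    obtain ⟨u, -, hx⟩ := hx
    obtain ⟨h1, rfl | ⟨v, -, j, hj, rfl⟩⟩ := (mem_readVars_outerItems ..).1 hx
    · exact ⟨h1, hsw o List.mem_cons_self u u⟩
    · exact ⟨h1, hsw j (List.mem_cons_of_mem _ hj) u v⟩
  · exact forall₃_congr fun i hi hi' => by rw [run_scanItems l ν s hos hJ hk i hi hi']

/-- The truth values of all queries `h_{k,i}` but one can be tested. -/
theorem Buildable.all_but_one (hk : 1 ≤ k) (m : Fin (k + 1)) (θ : Finset (Fin (k + 1))) :
    Buildable Set.univ fun D => ∀ i : Fin (k + 1), i ≠ m → (h k i D ↔ i ∈ θ) := by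
  -- Omitting `h_{k,m}` cuts the chain between the atoms `m` and `m + 1`. The lower part is scanned
  -- with `R` as outer atom, grouped by `x`, the upper part with `T` as outer atom, grouped by `y`.
  set L := (List.finRange (k + 2)).filter fun j : Fin (k + 2) => decide ((j : ℕ) ≠ 0 ∧ (j : ℕ) ≤ m) with hL
  set R := (List.finRange (k + 2)).filter fun j : Fin (k + 2) => decide ((j : ℕ) ≠ k + 1 ∧ (m : ℕ) < j) with hR
  have hm := m.2
  have mL : ∀ j : Fin (k + 2), j ∈ (0 : Fin (k + 2)) :: L ↔ (j : ℕ) ≤ m := fun j => by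
    simp only [hL, List.mem_cons, List.mem_filter, List.mem_finRange, true_and, decide_eq_true_eq,
      Fin.ext_iff, Fin.val_zero]
    omega
  have mR : ∀ j : Fin (k + 2), j ∈ Fin.last (k + 1) :: R ↔ (m : ℕ) < j := fun j => by
    simp only [hR, List.mem_cons, List.mem_filter, List.mem_finRange, true_and, decide_eq_true_eq,
      Fin.ext_iff, Fin.val_last]
    omega
  have hl := Buildable.scan Bool.false (o := 0) (J := L) rfl
    (fun j hj => by
      have := of_decide_eq_true (List.mem_filter.1 hj).2
      omega) hk ((List.nodup_finRange _).filter _) θ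
  have hr := Buildable.scan Bool.true (o := Fin.last (k + 1)) (J := R) rfl
    (fun j hj => by
      have := of_decide_eq_true (List.mem_filter.1 hj).2
      omega) hk ((List.nodup_finRange _).filter _) θ
  simp only [mL] at hl
  simp only [mR] at hr
  refine (hl.and hr ?_).congr fun D => ?_
  -- Facts of the two parts have different atom numbers.
  · rw [Set.disjoint_left]
    rintro x ⟨i, hi, u, v, rfl⟩ ⟨j, hj, u', v', h⟩
    have := (atom_inj (Nat.lt_succ_iff.1 i.2) (Nat.lt_succ_iff.1 j.2) h).1
    omega
  · simp only [Fin.val_castSucc, Fin.val_succ]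
    constructor
    · rintro ⟨h1, h2⟩ i hi
      have := Fin.val_ne_of_ne hi
      rcases lt_or_gt_of_ne this with h | h
      · exact h1 i h.le h
      · exact h2 i h (by omega)
    · intro H
      exact ⟨fun i _ h => H i (fun e => by subst e; omega),
        fun i h _ => H i (fun e => by subst e; omega)⟩

end
end HQuery

namespace HQuery

/-! ### Boolean functions with Euler characteristic zero -/

section
variable {k : ℕ}

/-- The parity of a valuation, as a sign. -/
def sgn (ν : Finset (Fin (k + 1))) : ℤ := (-1) ^ ν.card

/-- The Euler characteristic of a set of valuations. -/
def euler (S : Finset (Finset (Fin (k + 1)))) : ℤ := ∑ ν ∈ S, sgn ν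

theorem mem_flip {ν : Finset (Fin (k + 1))} {l i : Fin (k + 1)} :
    i ∈ flip ν l ↔ (i = l ∧ l ∉ ν) ∨ (i ≠ l ∧ i ∈ ν) := by
  unfold flip
  split_ifs with h <;> by_cases hi : i = l <;> simp [hi, h]

theorem flip_flip (ν : Finset (Fin (k + 1))) (l : Fin (k + 1)) : flip (flip ν l) l = ν := by
  ext i
  by_cases hi : i = l <;> simp [mem_flip, hi]

theorem sgn_flip (ν : Finset (Fin (k + 1))) (l : Fin (k + 1)) : sgn (flip ν l) = -sgn ν := by
  unfold flip sgn
  split_ifs with h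
  · obtain ⟨n, hn⟩ : ∃ n, ν.card = n + 1 := ⟨ν.card - 1, by
      have := Finset.card_pos.2 ⟨l, h⟩; omega⟩
    rw [Finset.card_erase_of_mem h, hn]
    simp [pow_succ]
  · rw [Finset.card_insert_of_notMem h, pow_succ]
    simp

theorem sgn_ne_zero (ν : Finset (Fin (k + 1))) : sgn ν ≠ 0 := by simp [sgn]

theorem flip_ne (ν : Finset (Fin (k + 1))) (l : Fin (k + 1)) : flip ν l ≠ ν := by
  intro h
  have h1 := sgn_flip ν l
  have h2 := sgn_ne_zero ν
  rw [h] at h1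
  omega

/-- Connectedness of the hypercube: flip the elements of the symmetric difference one by one. -/
theorem exists_foldl_flip (u w : Finset (Fin (k + 1))) : ∃ ls : List (Fin (k + 1)),
    ls.foldl flip u = w := by
  have key : ∀ T : Finset (Fin (k + 1)), ∃ ls : List (Fin (k + 1)),
      ∀ i, i ∈ ls.foldl flip u ↔ ¬ (i ∈ u ↔ i ∈ T) := by
    intro T
    induction T using Finset.induction_on with
    | empty => exact ⟨[], by simp⟩
    | insert a T ha ih =>
      obtain ⟨ls, h⟩ := ih
      refine ⟨ls ++ [a], fun i => ?_⟩
      rw [List.foldl_append, List.foldl_cons, List.foldl_nil, mem_flip, h, h]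
      by_cases hi : i = a
      · subst hi; simp [ha]
      · simp [hi]
  obtain ⟨ls, h⟩ := key (symmDiff u w)
  refine ⟨ls, Finset.ext fun i => ?_⟩
  rw [h, Finset.mem_symmDiff]
  by_cases h1 : i ∈ u <;> by_cases h2 : i ∈ w <;> simp [h1, h2]

variable {G : Finset (Finset (Fin (k + 1))) → Prop}
  (hadd : ∀ S ν l, G S → ν ∉ S → flip ν l ∉ S → G (S ∪ {ν, flip ν l}))
  (hcompl : ∀ S, G S → G Sᶜ)
include hadd

/-- Induction along a path in `S`'s surrounding hypercube between two members of opposite sign. If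
its first edge lies in `S`, that edge can be split off and `ih` applies. Otherwise the start is
moved two steps along the path, which keeps sign, cardinality and Euler characteristic. The path
ends must differ in sign, so the process ends with an edge. -/
theorem of_smaller_of_path (hremove : ∀ S ν l, G S → ν ∈ S → flip ν l ∈ S → G (S \ {ν, flip ν l}))
    (n : ℕ) (ih : ∀ S, S.card < n → euler S = 0 → G S) :
    ∀ (ls : List (Fin (k + 1))) (S : Finset (Finset (Fin (k + 1)))) (u : Finset (Fin (k + 1))),
      S.card = n → euler S = 0 → u ∈ S → ls.foldl flip u ∈ S → sgn u ≠ sgn (ls.foldl flip u) →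
      G S := by
  -- The two ends of an edge have opposite signs, so removing it keeps the Euler characteristic at
  -- zero.
  have edge : ∀ (S : Finset (Finset (Fin (k + 1)))) u l, S.card = n → euler S = 0 → u ∈ S →
      flip u l ∈ S → G S := by
    intro S u l hn hS hu hl
    have hsub : ({u, flip u l} : Finset _) ⊆ S := by
      simp [Finset.insert_subset_iff, hu, hl]
    have h1 : S \ {u, flip u l} ∪ {u, flip u l} = S := Finset.sdiff_union_of_subset hsub
    have h2 : euler (S \ {u, flip u l}) = 0 := by
      have := Finset.sum_sdiff (f := sgn) hsub
      rw [Finset.sum_pair (flip_ne u l).symm, sgn_flip] at this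
      unfold euler at hS ⊢
      omega
    have h3 : (S \ {u, flip u l}).card < n := by
      rw [← hn]
      exact Finset.card_lt_card (Finset.sdiff_ssubset hsub ⟨u, by simp⟩)
    rw [← h1]
    exact hadd _ _ _ (ih _ h3 h2) (by simp) (by simp)
  intro ls
  induction ls using List.twoStepInduction with
  | nil => intro S u _ _ _ _ h; exact absurd rfl h
  | singleton l => intro S u hn hS hu hl _; exact edge S u l hn hS hu hl
  | cons_cons a b ls ihls _ =>
    intro S u hn hS hu hw hsgn
    simp only [List.foldl_cons] at hw hsgn
    set w := ls.foldl flip (flip (flip u a) b) with hw'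
    by_cases h1 : flip u a ∈ S
    · exact edge S u a hn hS hu h1
    have h2 : sgn (flip (flip u a) b) = sgn u := by rw [sgn_flip, sgn_flip, neg_neg]
    by_cases h3 : flip (flip u a) b ∈ S
    · exact ihls S _ hn hS h3 hw (by rw [h2]; exact hsgn)
    -- move `u` by two steps
    set p := flip u a with hp
    set v := flip p b with hv
    have hvu : v ≠ u := fun h => h3 (h ▸ hu)
    have hvp : v ≠ p := flip_ne p b
    have hpu : p ≠ u := flip_ne u a
    have hwu : w ≠ u := fun h => hsgn (by rw [h])
    have hv' : v ∉ S.erase u := fun h => h3 (Finset.mem_of_mem_erase h)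
    have h4 : G (insert v (S.erase u)) := by
      refine ihls _ v ?_ ?_ (Finset.mem_insert_self _ _)
        (Finset.mem_insert_of_mem (Finset.mem_erase.2 ⟨hwu, hw⟩)) (by rw [h2]; exact hsgn)
      · rw [Finset.card_insert_of_notMem hv', Finset.card_erase_of_mem hu]
        have := Finset.card_pos.2 ⟨u, hu⟩
        omega
      · have := Finset.add_sum_erase S sgn hu
        unfold euler at hS ⊢
        rw [Finset.sum_insert hv', h2, this, hS]
    -- Undo the move: in `S` with `u` replaced by `v`, add the edge `{u, p}` and then remove the
    -- edge `{p, v}`; the result is `S`.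
    have h5 := hadd _ u a h4 (by simp [hvu.symm]) (by simp [hvp.symm, ← hp, h1])
    have h6 := hremove _ p b h5 (by simp [← hp]) (by simp [← hv])
    convert h6 using 1
    rw [← hp, ← hv]
    ext x
    simp only [Finset.mem_sdiff, Finset.mem_union, Finset.mem_insert, Finset.mem_erase,
      Finset.mem_singleton]
    grind

include hcompl in
/-- The sets of valuations with Euler characteristic zero are generated from the empty set by
adding disjoint edges of the hypercube and taking complements. -/
theorem of_euler_eq_zero (h0 : G ∅) (S : Finset (Finset (Fin (k + 1)))) (hS : euler S = 0) :
    G S := by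
  -- Removing an edge is adding it to the complement.
  have hremove : ∀ S ν l, G S → ν ∈ S → flip ν l ∈ S → G (S \ {ν, flip ν l}) := by
    intro S ν l hG h1 h2
    have := hcompl _ (hadd _ ν l (hcompl S hG) (by simpa using h1) (by simpa using h2))
    rwa [Finset.compl_union, compl_compl, ← Finset.sdiff_eq_inter_compl] at this
  induction hn : S.card using Nat.strong_induction_on generalizing S with
  | _ n ih =>
    rcases S.eq_empty_or_nonempty with rfl | ⟨u, hu⟩
    · exact h0
    -- In a nonempty set with valuations of one sign only, nothing would cancel.
    · obtain ⟨w, hw, huw⟩ : ∃ w ∈ S, sgn u ≠ sgn w := by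
        by_contra! hall
        have : euler S = S.card * sgn u := by
          rw [euler, Finset.sum_congr rfl fun w hw => (hall w hw).symm]
          simp
        rw [this, mul_eq_zero] at hS
        rcases hS with hS | hS
        · have := Finset.card_pos.2 ⟨u, hu⟩
          omega
        · exact sgn_ne_zero u hS
      obtain ⟨ls, rfl⟩ := exists_foldl_flip u w
      exact of_smaller_of_path hadd hremove n (fun S' h h' => ih _ h S' h' rfl) ls S u hn hS hu hw
        huw

end
end HQuery

namespace HQuery

/-! ### Safe queries have Euler characteristic zero -/

section
variable {k : ℕ}

/-- The valuations that satisfy `φ`. -/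
def satSet (φ : BoolFun k) : Finset (Finset (Fin (k + 1))) :=
  Finset.univ.filter fun ν => φ ν = true

/-- Flipping a variable on which `φ` does not depend is a fixed-point-free, sign-reversing
involution of the satisfying valuations. -/
theorem euler_satSet_of_degenerate {φ : BoolFun k} (h : ¬ Nondegenerate φ) :
    euler (satSet φ) = 0 := by
  obtain ⟨l, hl⟩ : ∃ l, ∀ ν, φ ν = φ (flip ν l) := by
    simpa [Nondegenerate, DependsOn] using h
  refine Finset.sum_involution (fun ν _ => flip ν l) (fun ν _ => ?_) (fun ν _ _ => flip_ne ν l)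
    (fun ν hν => ?_) fun ν _ => flip_flip ν l
  · rw [sgn_flip]; omega
  · simpa [satSet, ← hl] using hν

open Classical in
theorem sum_sgn_powerset (W : Finset (Fin (k + 1))) :
    ∑ ν ∈ W.powerset, sgn ν = if W = ∅ then 1 else 0 := by
  convert Finset.sum_powerset_neg_one_pow_card (x := W) using 1
  congr

open Classical in
/-- The Euler characteristic by inclusion and exclusion on the clauses. -/
theorem euler_satSet_of_isMinCNF {F : Finset (Finset (Fin (k + 1)))} {φ : BoolFun k}
    (h : IsMinCNF F φ) : euler (satSet φ) =
      ∑ s ∈ F.powerset, if s.biUnion id = Finset.univ then (-1 : ℤ) ^ s.card else 0 := by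
  -- `ν` satisfies `φ` iff no clause is disjoint from `ν`, and the alternating sum over the sets of
  -- clauses disjoint from `ν` detects this.
  have h1 : ∀ ν, (if φ ν = true then sgn ν else 0) =
      ∑ s ∈ F.powerset, if ν ⊆ (s.biUnion id)ᶜ then (-1 : ℤ) ^ s.card * sgn ν else 0 := by
    intro ν
    have e : F.powerset.filter (fun s => ν ⊆ (s.biUnion id)ᶜ) =
        (F.filter fun C => Disjoint C ν).powerset := by
      ext s
      have : ν ⊆ (s.biUnion id)ᶜ ↔ ∀ C ∈ s, Disjoint C ν := by
        rw [Finset.subset_compl_comm, Finset.biUnion_subset]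
        refine forall₂_congr fun C _ => ?_
        simp [Finset.disjoint_left, Finset.subset_iff]
      rw [Finset.mem_filter, Finset.mem_powerset, Finset.mem_powerset, this]
      simp only [Finset.subset_iff, Finset.mem_filter]
      grind
    rw [← Finset.sum_filter, e, ← Finset.sum_mul, Finset.sum_powerset_neg_one_pow_card]
    have : φ ν = true ↔ (F.filter fun C => Disjoint C ν) = ∅ := by
      rw [h.1, Finset.filter_eq_empty_iff]
      exact forall₂_congr fun C _ => by rw [Finset.disjoint_iff_inter_eq_empty,
        Finset.nonempty_iff_ne_empty]
    simp [this]
  -- After exchanging the sums, `ν` runs over the subsets of the complement of the union of `s`;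
  -- their signs cancel unless that complement is empty.
  rw [euler, satSet, Finset.sum_filter, Finset.sum_congr rfl fun ν _ => h1 ν, Finset.sum_comm]
  refine Finset.sum_congr rfl fun s _ => ?_
  have e : Finset.univ.filter (fun ν => ν ⊆ (s.biUnion id)ᶜ) = ((s.biUnion id)ᶜ).powerset := by
    ext ν; simp
  rw [← Finset.sum_filter, e, ← Finset.mul_sum, sum_sgn_powerset]
  by_cases hs : s.biUnion id = Finset.univ <;> simp [hs]

/-! ### The Möbius function of the CNF lattice -/

theorem CNFLattice.le_latTop {F : Finset (Finset (Fin (k + 1)))} (x : CNFLattice F) :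
    x ≤ latTop F := by
  change (∅ : Finset (Fin (k + 1))) ⊆ OrderDual.ofDual x.1
  simp

instance {F : Finset (Finset (Fin (k + 1)))} : OrderTop (CNFLattice F) where
  top := latTop F
  le_top := CNFLattice.le_latTop

open Classical in
/-- The alternating sum over the sets of clauses with a given union. -/
noncomputable def altSum (F : Finset (Finset (Fin (k + 1)))) (x : CNFLattice F) : ℤ :=
  ∑ s ∈ F.powerset, if s.biUnion id = OrderDual.ofDual x.1 then (-1 : ℤ) ^ s.card else 0

theorem CNFLattice.eq_latTop_iff {F : Finset (Finset (Fin (k + 1)))} (hF : ∅ ∉ F)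
    (x : CNFLattice F) : x = latTop F ↔ ∀ C ∈ F, ¬ C ⊆ OrderDual.ofDual x.1 := by
  constructor
  · rintro rfl C hC h
    have : C = ∅ := Finset.subset_empty.1 h
    exact hF (this ▸ hC)
  · intro h
    obtain ⟨x, s, hs, hx⟩ := x
    have : s = ∅ := by
      by_contra hne
      obtain ⟨C, hC⟩ := Finset.nonempty_iff_ne_empty.2 hne
      exact h C (hs hC) (hx.symm ▸ Finset.subset_biUnion_of_mem id hC)
    subst this
    exact Subtype.ext hx

open Classical in
-- Each set of clauses is counted at its own union, so the right-hand side is the alternating sum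
-- over all sets of clauses contained in `x`. It vanishes unless there is no such clause, which, as
-- `∅ ∉ F`, means that `x` is the empty union.
theorem sum_altSum {F : Finset (Finset (Fin (k + 1)))} (hF : ∅ ∉ F) (x : CNFLattice F) :
    (if x = latTop F then (1 : ℤ) else 0) = ∑ y with x ≤ y, altSum F y := by
  unfold altSum
  rw [Finset.sum_comm]
  have e : ∀ s ∈ F.powerset, (∑ y with x ≤ y,
      if s.biUnion id = OrderDual.ofDual y.1 then (-1 : ℤ) ^ s.card else 0) =
      if s.biUnion id ⊆ OrderDual.ofDual x.1 then (-1 : ℤ) ^ s.card else 0 := by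
    intro s hs
    obtain ⟨y₀, hy₀⟩ : ∃ y : CNFLattice F, OrderDual.ofDual y.1 = s.biUnion id :=
      ⟨⟨OrderDual.toDual (s.biUnion id), s, Finset.mem_powerset.1 hs, rfl⟩, rfl⟩
    have h1 : ∀ y : CNFLattice F, s.biUnion id = OrderDual.ofDual y.1 ↔ y₀ = y := by
      intro y
      rw [← hy₀, Subtype.ext_iff, OrderDual.ofDual_inj]
    have h2 : x ≤ y₀ ↔ s.biUnion id ⊆ OrderDual.ofDual x.1 := by
      rw [← hy₀]
      rfl
    simp only [h1, Finset.sum_ite_eq, Finset.mem_filter, Finset.mem_univ, true_and, h2]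
  rw [Finset.sum_congr rfl e, ← Finset.sum_filter]
  have e' : F.powerset.filter (fun s => s.biUnion id ⊆ OrderDual.ofDual x.1) =
      (F.filter fun C => C ⊆ OrderDual.ofDual x.1).powerset := by
    ext s
    simp only [Finset.mem_filter, Finset.mem_powerset, Finset.biUnion_subset, id,
      Finset.subset_iff (s₁ := s)]
    exact ⟨fun h C hC => ⟨h.1 hC, h.2 C hC⟩, fun h => ⟨fun C hC => (h hC).1, fun C hC => (h hC).2⟩⟩
  rw [e', Finset.sum_powerset_neg_one_pow_card]
  exact if_congr ((CNFLattice.eq_latTop_iff hF x).trans Finset.filter_eq_empty_iff.symm) rfl rfl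

/-- Möbius inversion for the indicator function of the greatest element. -/
theorem eq_mu_top {α : Type*} [PartialOrder α] [OrderTop α] [LocallyFiniteOrder α] [DecidableEq α]
    [Fintype α] [DecidableLE α] {f : α → ℤ}
    (hf : ∀ x, (if x = ⊤ then (1 : ℤ) else 0) = ∑ y with x ≤ y, f y) (x : α) :
    f x = IncidenceAlgebra.mu ℤ x ⊤ := by
  have h := IncidenceAlgebra.moebius_inversion_top f (fun x => if x = ⊤ then (1 : ℤ) else 0)
    (fun x => (hf x).trans (Finset.sum_congr (by ext y; simp) fun _ _ => rfl)) x
  simpa using h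

/-- The Möbius function by alternating sums over the sets of clauses. -/
theorem cnfMoebius_eq_altSum {F : Finset (Finset (Fin (k + 1)))} (hF : ∅ ∉ F) :
    cnfMoebius F = altSum F (latBot F) := by
  classical
  exact (eq_mu_top (f := altSum F) (fun x => by convert sum_altSum hF x; rfl) (latBot F)).symm

theorem euler_satSet_of_isSafe {φ : BoolFun k} (h : IsSafe φ) : euler (satSet φ) = 0 := by
  classical
  rcases h with h | ⟨F, hF, h0⟩
  · exact euler_satSet_of_degenerate h
  -- An empty clause makes `φ` unsatisfiable; this case is apart because the Möbius computation
  -- needs nonempty clauses.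
  · by_cases hemp : ∅ ∈ F
    · have : satSet φ = ∅ := Finset.filter_eq_empty_iff.2 fun ν _ hν => by
        simpa using (hF.1 ν).1 hν ∅ hemp
      simp [this, euler]
    · rw [euler_satSet_of_isMinCNF hF]
      -- If the clauses cover `V`, the sum is the Möbius value; if not, no set of clauses has union
      -- `V` and all terms vanish.
      by_cases hu : F.biUnion id = Finset.univ
      · have := cnfMoebius_eq_altSum hemp
        simpa [altSum, latBot, hu, h0] using this.symm
      · refine Finset.sum_eq_zero fun s hs => if_neg fun h => hu ?_
        exact Finset.univ_subset_iff.1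
          (h ▸ Finset.biUnion_subset_biUnion_of_subset_left _ (Finset.mem_powerset.1 hs))

/-! ### The main theorem -/

open Classical in
-- A set `S` of valuations stands for the query that the set of true `h_{k,i}` belongs to `S`. The
-- generation principle applies: an edge in direction `l` leaves exactly `h_{k,l}` free, disjoint
-- unions are exclusive disjunctions, and complements are negations.
theorem buildable_of_euler_eq_zero (hk : 1 ≤ k) (S : Finset (Finset (Fin (k + 1))))
    (hS : euler S = 0) :
    Buildable Set.univ fun D => (Finset.univ.filter fun i => h k i D) ∈ S := by
  refine of_euler_eq_zero
    (G := fun S => Buildable Set.univ fun D => (Finset.univ.filter fun i => h k i D) ∈ S)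
    ?_ ?_ ?_ S hS
  · intro S ν l hG h1 h2
    have hedge : Buildable Set.univ fun D =>
        (Finset.univ.filter fun i => h k i D) ∈ ({ν, flip ν l} : Finset _) := by
      refine (Buildable.all_but_one hk l ν).congr fun D => ?_
      simp only [Finset.mem_insert, Finset.mem_singleton, Finset.ext_iff, Finset.mem_filter,
        Finset.mem_univ, true_and, mem_flip]
      constructor
      · intro H
        by_cases hl : h k l D ↔ l ∈ ν
        · left
          intro i
          by_cases hi : i = l
          · rw [hi]; exact hl
          · exact H i hi
        · right
          intro i
          by_cases hi : i = l
          · subst hi; simp; tauto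
          · simp [hi, H i hi]
      · rintro (H | H) i hi
        · exact H i
        · simpa [hi] using H i
    refine (hG.or hedge fun D => ?_).congr fun D => Finset.mem_union.symm
    rintro ⟨h3, h4⟩
    rcases Finset.mem_insert.1 h4 with h4 | h4
    · exact h1 (h4 ▸ h3)
    · exact h2 (Finset.mem_singleton.1 h4 ▸ h3)
  · exact fun S hG => hG.not.congr fun D => Finset.mem_compl.symm
  · exact Buildable.false.congr fun D => by simp

end
end HQuery

/-- All safe `H⁺`-queries have d-D lineages computable in polynomial time. -/
theorem mainTheorem2 (k : ℕ) (hk : 1 ≤ k) (φ : HQuery.BoolFun k) (hmono : Monotone φ)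
    (hsafe : HQuery.IsSafe φ) : HQuery.InDDPTIME (HQuery.Qof φ) := by
  refine ((HQuery.buildable_of_euler_eq_zero hk _
    (HQuery.euler_satSet_of_isSafe hsafe)).congr fun D => ?_).inDDPTIME
  simp [HQuery.satSet, HQuery.Qof]
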